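/- **Model.** The network is a graph $G=(V,E)$ with $n\ge 1$ nodes and maximum degree $\Delta$; time proceeds in synchronous rounds. All nodes run the same program, have independent private randomness, and initially know only their own degree, upper bounds $N$ and $D$ with $n\le N\le n^c$ and $\Delta\le D\le\Delta^c$ (polynomially tight estimates of $n$ and $\Delta$), and the parameter $\varepsilon$; they see their incident edges through arbitrarily numbered ports. In each round, each node that has not terminated is awake or sleeping. An awake node may send a message to each of its neighbours, receives the messages sent in that round by its awake neighbours, updates its state, and decides either to terminate or for how many rounds to sleep before its next awake round (such a decision is also made at the start). A sleeping node neither sends nor receives anything, and performs no computation. The awake complexity $A_v$ of a node $v$ is the number of rounds in which it is awake, and the node-averaged awake complexity is $\frac1n\sum_{v\in V}A_v$. The round complexity is the number of rounds until all nodes have terminated. A fractional matching is a family $(x_e)_{e\in E}$ with $x_e\ge 0$ and $\sum_{e\ni v}x_e\le 1$ for all $v\in V$; its size is $\sum_{e\in E}x_e$, and $\nu^*(G)$ denotes the maximum size of a fractional matching of $G$. An algorithm outputs $(x_e)$ if each node outputs the values $x_e$ of its incident edges. **Statement.** For every integer $c\ge 1$ there is a constant $K>0$ (depending only on $c$) such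 that for every $0<\varepsilon\le 1/1000$ there is a randomized algorithm in this model with the following properties on every graph $G$ with $\nu^*(G)\ge K(\log n)^{18}$, every port numbering, and all estimates $N,D$ as above. 1. Always (for every outcome of the randomness): all nodes have terminated after at most $K(1+\log\Delta)/\varepsilon$ rounds (with $\log 0$ read as $0$), that is $O(\log\Delta)$ rounds for fixed $\varepsilon$ and $\Delta\ge 2$; all messages have at most $K\log n$ bits; and the output is a fractional matching of $G$. 2. With probability at least $1-n^{-5}$, both of the following hold: the output $x$ is a $(2+100\varepsilon)$-approximation of the maximum fractional matching, that is $\nu^*(G)\le(2+100\varepsilon)\sum_{e\in E}x_e$, and the node-averaged awake complexity is at most $K\varepsilon^{-3}$. -/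

import Mathlib

open MeasureTheory

/-! ### Fractional matchings -/

/-- `x` assigns to every edge a value `≥ 0` (and `0` to every non-edge), so that the values of the
edges at each node sum to at most `1`. -/
structure IsFractionalMatching {V : Type} [Fintype V] [DecidableEq V] (G : SimpleGraph V)
    [DecidableRel G.Adj] (x : Sym2 V → ℝ) : Prop where
  nonneg : ∀ e, 0 ≤ x e
  eq_zero : ∀ e, e ∉ G.edgeSet → x e = 0
  sum_le_one : ∀ v, ∑ e ∈ G.incidenceFinset v, x e ≤ 1

/-- The size of a fractional matching. -/
def fractionalSize {V : Type} [Fintype V] [DecidableEq V] (G : SimpleGraph V)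
    [DecidableRel G.Adj] (x : Sym2 V → ℝ) : ℝ :=
  ∑ e ∈ G.edgeFinset, x e

/-- The size of a maximum fractional matching. The supremum is over a nonempty bounded set, see
`fractionalSizes_nonempty` and `fractionalSizes_bddAbove`. -/
noncomputable def maxFractionalMatching {V : Type} [Fintype V] [DecidableEq V]
    (G : SimpleGraph V) [DecidableRel G.Adj] : ℝ :=
  sSup {s | ∃ x, IsFractionalMatching G x ∧ s = fractionalSize G x}

theorem fractionalSizes_nonempty {V : Type} [Fintype V] [DecidableEq V] (G : SimpleGraph V)
    [DecidableRel G.Adj] :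
    {s | ∃ x, IsFractionalMatching G x ∧ s = fractionalSize G x}.Nonempty :=
  ⟨_, fun _ => 0, ⟨fun _ => le_rfl, fun _ _ => rfl, fun _ => by simp⟩, rfl⟩

theorem fractionalSizes_bddAbove {V : Type} [Fintype V] [DecidableEq V] (G : SimpleGraph V)
    [DecidableRel G.Adj] :
    BddAbove {s | ∃ x, IsFractionalMatching G x ∧ s = fractionalSize G x} := by
  refine ⟨∑ _e ∈ G.edgeFinset, 1, ?_⟩
  rintro _ ⟨x, hx, rfl⟩
  refine Finset.sum_le_sum fun e he => ?_
  induction e with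
  | h v w =>
    have hmem : s(v, w) ∈ G.incidenceFinset v := by
      rw [SimpleGraph.mem_incidenceFinset]
      exact ⟨SimpleGraph.mem_edgeFinset.1 he, Sym2.mem_mk_left v w⟩
    exact (Finset.single_le_sum (fun e _ => hx.nonneg e) hmem).trans (hx.sum_le_one v)

/-! ### The distributed sleeping model

Synchronous message passing on a graph whose nodes see their incident edges through numbered ports.
All nodes run the same program, and they are anonymous. Time is divided into rounds `0, 1, 2, …`;
in each round a node is awake, or asleep, or has terminated. -/

/-- The program run by every node. The argument `d : ℕ` is always the degree of the node that
executes the program, and `Fin d` is its set of ports. -/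
structure NodeProgram where
  /-- Values of the private randomness of one node. -/
  Seed : Type
  /-- Local states. -/
  State : Type
  /-- The distribution of the private randomness of one node. -/
  law : PMF Seed
  /-- The initial state, from the degree and the private randomness. -/
  init : (d : ℕ) → Seed → State
  /-- The message (a bit string, or nothing) that an awake node sends over each of its ports. -/
  send : (d : ℕ) → State → Fin d → Option (List Bool)
  /-- The state of an awake node at the end of the round, from its state at the beginning of the
  round and the messages received over its ports in this round. -/
  step : (d : ℕ) → State → (Fin d → Option (List Bool)) → State
  /-- What a node decides to do next, initially and after each of its awake rounds: `some k` is to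
  sleep for the next `k` rounds and then to be awake for a round, `none` is to terminate. -/
  wait : State → Option ℕ
  /-- The output of a node: a value for each of its incident edges. -/
  output : (d : ℕ) → State → Fin d → ℝ

/-- A numbering of the edges at each node by ports. -/
abbrev PortNumbering {V : Type} [Fintype V] (G : SimpleGraph V) [DecidableRel G.Adj] : Type :=
  (v : V) → Fin (G.degree v) ≃ G.neighborSet v

namespace NodeProgram

/-- A local state together with an alarm: `some k` if the node is asleep for `k` more rounds and
then awake (so `some 0` if it is awake in the present round), and `none` if it has terminated. -/
abbrev Status (P : NodeProgram) : Type := P.State × Option ℕ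

/-- What `v` receives over its ports, if it is awake: only messages of awake neighbours. -/
def inbox {V : Type} [Fintype V] {G : SimpleGraph V} [DecidableRel G.Adj] (P : NodeProgram)
    (port : PortNumbering G) (c : V → P.Status) (v : V) (p : Fin (G.degree v)) :
    Option (List Bool) :=
  let u := port v p
  if (c u).2 = some 0 then
    P.send (G.degree u) (c u).1 ((port u).symm ⟨v, SimpleGraph.Adj.symm u.2⟩)
  else none

/-- One round: awake nodes exchange messages and update their state, sleeping nodes only get closer
to their alarm, and terminated nodes do nothing. -/
def round {V : Type} [Fintype V] {G : SimpleGraph V} [DecidableRel G.Adj] (P : NodeProgram)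
    (port : PortNumbering G) (c : V → P.Status) : V → P.Status := fun v =>
  match (c v).2 with
  | none => c v
  | some (k + 1) => ((c v).1, some k)
  | some 0 =>
    let s := P.step (G.degree v) (c v).1 (P.inbox port c v)
    (s, P.wait s)

/-- The statuses of all nodes at the beginning of round `t`, if the private randomness takes the
value `ω`. -/
def run {V : Type} [Fintype V] {G : SimpleGraph V} [DecidableRel G.Adj] (P : NodeProgram)
    (port : PortNumbering G) (ω : V → P.Seed) : ℕ → V → P.Status
  | 0 => fun v => let s := P.init (G.degree v) (ω v); (s, P.wait s)
  | t + 1 => P.round port (P.run port ω t)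

/-- Node `v` is awake in round `t`. -/
def Awake {V : Type} [Fintype V] {G : SimpleGraph V} [DecidableRel G.Adj] (P : NodeProgram)
    (port : PortNumbering G) (ω : V → P.Seed) (t : ℕ) (v : V) : Prop :=
  (P.run port ω t v).2 = some 0

/-- All nodes have terminated after `T` rounds. From then on no state changes and no node is
awake. -/
def TerminatesWithin {V : Type} [Fintype V] {G : SimpleGraph V} [DecidableRel G.Adj]
    (P : NodeProgram) (port : PortNumbering G) (ω : V → P.Seed) (T : ℕ) : Prop :=
  ∀ v, (P.run port ω T v).2 = none

/-- The awake complexity of `v`: the number of rounds in which `v` is awake. (This is a finite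
number if the nodes terminate.) -/
noncomputable def awakeComplexity {V : Type} [Fintype V] {G : SimpleGraph V} [DecidableRel G.Adj]
    (P : NodeProgram) (port : PortNumbering G) (ω : V → P.Seed) (v : V) : ℕ :=
  {t | P.Awake port ω t v}.ncard

/-- The node-averaged awake complexity. -/
noncomputable def avgAwakeComplexity {V : Type} [Fintype V] {G : SimpleGraph V}
    [DecidableRel G.Adj] (P : NodeProgram) (port : PortNumbering G) (ω : V → P.Seed) : ℝ :=
  (∑ v, (P.awakeComplexity port ω v : ℝ)) / Fintype.card V

/-- All messages that are sent have at most `b` bits. -/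
def MessagesAtMost {V : Type} [Fintype V] {G : SimpleGraph V} [DecidableRel G.Adj]
    (P : NodeProgram) (port : PortNumbering G) (ω : V → P.Seed) (b : ℝ) : Prop :=
  ∀ t v, P.Awake port ω t v → ∀ p, ∀ m ∈ P.send (G.degree v) (P.run port ω t v).1 p,
    (m.length : ℝ) ≤ b

/-- After `T` rounds, both endpoints of every edge output the value that `x` gives to the edge. -/
def Outputs {V : Type} [Fintype V] {G : SimpleGraph V} [DecidableRel G.Adj] (P : NodeProgram)
    (port : PortNumbering G) (ω : V → P.Seed) (T : ℕ) (x : Sym2 V → ℝ) : Prop :=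
  ∀ v p, P.output (G.degree v) (P.run port ω T v).1 p = x s(v, (port v p : V))

instance (P : NodeProgram) : MeasurableSpace P.Seed := ⊤

/-- The joint distribution of the private randomness: independent over the nodes. -/
noncomputable def seedMeasure (P : NodeProgram) (V : Type) [Fintype V] : Measure (V → P.Seed) :=
  Measure.pi fun _ => P.law.toMeasure

instance (P : NodeProgram) (V : Type) [Fintype V] : IsProbabilityMeasure (P.seedMeasure V) := by
  unfold seedMeasure; infer_instance

end NodeProgram

/-! ### Expectations over finite products -/

section ProductExpectation

variable {ι α : Type} [Fintype ι] [DecidableEq ι] [Fintype α]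

/-- The expectation of `f` if the coordinates are independent and coordinate `i` has law `P i`. -/
def prodExp (P : ι → α → ℝ) (f : (ι → α) → ℝ) : ℝ := ∑ ω, (∏ i, P i (ω i)) * f ω

/-- The average of `f` over coordinate `i`. -/
def coordAvg (P : ι → α → ℝ) (i : ι) (f : (ι → α) → ℝ) (ω : ι → α) : ℝ :=
  ∑ a, P i a * f (Function.update ω i a)

/-- The average of `f` over all coordinates in a list. -/
def listAvg (P : ι → α → ℝ) (l : List ι) (f : (ι → α) → ℝ) : (ι → α) → ℝ :=
  l.foldr (fun i g => coordAvg P i g) f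

/-- `P i` is a probability vector for every `i`. -/
structure IsLaw (P : ι → α → ℝ) : Prop where
  nonneg : ∀ i a, 0 ≤ P i a
  sum_eq_one : ∀ i, ∑ a, P i a = 1

variable {P : ι → α → ℝ}

theorem prodExp_mono (hP : IsLaw P) {f g : (ι → α) → ℝ} (h : ∀ ω, f ω ≤ g ω) :
    prodExp P f ≤ prodExp P g :=
  Finset.sum_le_sum fun ω _ => mul_le_mul_of_nonneg_left (h ω)
    (Finset.prod_nonneg fun i _ => hP.nonneg i _)

theorem prodExp_sum {κ : Type} (s : Finset κ) (f : κ → (ι → α) → ℝ) :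
    prodExp P (fun ω => ∑ k ∈ s, f k ω) = ∑ k ∈ s, prodExp P (f k) := by
  simp only [prodExp, Finset.mul_sum]
  exact Finset.sum_comm

theorem prodExp_mul_left (r : ℝ) (f : (ι → α) → ℝ) :
    prodExp P (fun ω => r * f ω) = r * prodExp P f := by
  simp only [prodExp, Finset.mul_sum]
  exact Finset.sum_congr rfl fun ω _ => by ring

theorem prodExp_add (f g : (ι → α) → ℝ) :
    prodExp P (fun ω => f ω + g ω) = prodExp P f + prodExp P g := by
  simp only [prodExp, mul_add, Finset.sum_add_distrib]

theorem prodExp_sub (f g : (ι → α) → ℝ) :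
    prodExp P (fun ω => f ω - g ω) = prodExp P f - prodExp P g := by
  simp only [prodExp, mul_sub, Finset.sum_sub_distrib]

theorem prodExp_const (hP : IsLaw P) (r : ℝ) : prodExp P (fun _ => r) = r := by
  rw [prodExp, ← Finset.sum_mul, ← Fintype.prod_sum]
  simp [hP.sum_eq_one]

omit [Fintype α] in
theorem prod_update_mul (P : ι → α → ℝ) (ω : ι → α) (i : ι) (a : α) :
    (∏ j, P j (ω j)) * P i a = (∏ j, P j (Function.update ω i a j)) * P i (ω i) := by
  have h1 := Finset.mul_prod_erase Finset.univ (fun j => P j (ω j)) (Finset.mem_univ i)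
  have h2 := Finset.mul_prod_erase Finset.univ (fun j => P j (Function.update ω i a j))
    (Finset.mem_univ i)
  have h3 : ∏ j ∈ Finset.univ.erase i, P j (Function.update ω i a j)
      = ∏ j ∈ Finset.univ.erase i, P j (ω j) :=
    Finset.prod_congr rfl fun j hj => by rw [Function.update_of_ne (Finset.ne_of_mem_erase hj)]
  rw [← h1, ← h2, h3]
  simp
  ring

theorem prodExp_coordAvg (hP : IsLaw P) (i : ι) (f : (ι → α) → ℝ) :
    prodExp P (coordAvg P i f) = prodExp P f := by
  have h1 : prodExp P (coordAvg P i f)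
      = ∑ x : (ι → α) × α, ((∏ j, P j (x.1 j)) * P i x.2) * f (Function.update x.1 i x.2) := by
    rw [Fintype.sum_prod_type]
    simp only [prodExp, coordAvg, Finset.mul_sum, mul_assoc]
  have h2 : prodExp P f = ∑ x : (ι → α) × α, ((∏ j, P j (x.1 j)) * P i x.2) * f x.1 := by
    rw [Fintype.sum_prod_type]
    refine Finset.sum_congr rfl fun ω _ => ?_
    dsimp only
    rw [← Finset.sum_mul, ← Finset.mul_sum, hP.sum_eq_one, mul_one]
  rw [h1, h2]
  refine Finset.sum_bij' (fun x _ => (Function.update x.1 i x.2, x.1 i))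
    (fun x _ => (Function.update x.1 i x.2, x.1 i)) (by simp) (by simp) ?_ ?_ ?_
  · rintro ⟨ω, a⟩ -
    simp
  · rintro ⟨ω, a⟩ -
    simp
  · rintro ⟨ω, a⟩ -
    rw [prod_update_mul]

/-- The law of one coordinate. -/
theorem prodExp_eval (hP : IsLaw P) (i : ι) (h : α → ℝ) :
    prodExp P (fun ω => h (ω i)) = ∑ a, P i a * h a := by
  rw [← prodExp_coordAvg hP i]
  have : coordAvg P i (fun ω => h (ω i)) = fun _ => ∑ a, P i a * h a := by
    funext ω
    simp [coordAvg]
  rw [this, prodExp_const hP]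

/-! ### The bounded differences inequality -/

theorem coordAvg_congr_update (i j : ι) {f : (ι → α) → ℝ}
    (hf : ∀ ω a, f (Function.update ω j a) = f ω) (ω : ι → α) (a : α) :
    coordAvg P i f (Function.update ω j a) = coordAvg P i f ω := by
  refine Finset.sum_congr rfl fun b _ => ?_
  by_cases h : i = j
  · subst h
    rw [Function.update_idem]
  · rw [Function.update_comm (Ne.symm h), hf]

theorem listAvg_update {l : List ι} (f : (ι → α) → ℝ) {j : ι} (hj : j ∈ l) (ω : ι → α) (a : α) :
    listAvg P l f (Function.update ω j a) = listAvg P l f ω := by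
  induction l generalizing ω a with
  | nil => simp at hj
  | cons i l ih =>
    change coordAvg P i (listAvg P l f) _ = coordAvg P i (listAvg P l f) _
    by_cases h : j = i
    · subst h
      simp [coordAvg]
    · exact coordAvg_congr_update i j
        (fun ω a => ih ((List.mem_cons.1 hj).resolve_left h) ω a) ω a

theorem listAvg_mul {l : List ι} {f g : (ι → α) → ℝ}
    (hg : ∀ j ∈ l, ∀ ω a, g (Function.update ω j a) = g ω) (ω : ι → α) :
    listAvg P l (fun ω => f ω * g ω) ω = listAvg P l f ω * g ω := by
  induction l generalizing ω with
  | nil => rfl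
  | cons i l ih =>
    change coordAvg P i (listAvg P l _) _ = coordAvg P i (listAvg P l f) _ * _
    simp only [coordAvg, Finset.sum_mul]
    refine Finset.sum_congr rfl fun a _ => ?_
    rw [ih (fun j hj => hg j (List.mem_cons_of_mem _ hj)), hg i List.mem_cons_self]
    ring

theorem coordAvg_abs_sub_le (hP : IsLaw P) (i j : ι) {c : ℝ} {f : (ι → α) → ℝ}
    (hf : ∀ ω a b, |f (Function.update ω j a) - f (Function.update ω j b)| ≤ c)
    (ω : ι → α) (a b : α) :
    |coordAvg P i f (Function.update ω j a) - coordAvg P i f (Function.update ω j b)| ≤ c := by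
  have hc : 0 ≤ c := (abs_nonneg _).trans (hf ω a a)
  by_cases h : i = j
  · subst h
    simpa [coordAvg] using hc
  · simp only [coordAvg, ← Finset.sum_sub_distrib, ← mul_sub]
    refine (Finset.abs_sum_le_sum_abs _ _).trans ?_
    calc _ ≤ ∑ x, P i x * c := by
          refine Finset.sum_le_sum fun x _ => ?_
          rw [abs_mul, abs_of_nonneg (hP.nonneg i x)]
          refine mul_le_mul_of_nonneg_left ?_ (hP.nonneg i x)
          rw [Function.update_comm (Ne.symm h), Function.update_comm (Ne.symm h)]
          exact hf _ _ _
      _ = c := by rw [← Finset.sum_mul, hP.sum_eq_one, one_mul]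

theorem listAvg_abs_sub_le (hP : IsLaw P) (l : List ι) (j : ι) {c : ℝ} {f : (ι → α) → ℝ}
    (hf : ∀ ω a b, |f (Function.update ω j a) - f (Function.update ω j b)| ≤ c) :
    ∀ ω a b,
      |listAvg P l f (Function.update ω j a) - listAvg P l f (Function.update ω j b)| ≤ c := by
  induction l with
  | nil => exact hf
  | cons i l ih => exact coordAvg_abs_sub_le hP i j ih

theorem exp_mul_le_chord {c x l : ℝ} (hc : 0 < c) (hx : |x| ≤ c) :
    Real.exp (l * x) ≤ Real.cosh (l * c) + x / c * Real.sinh (l * c) := by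
  have := Real.exp_mul_le_cosh_add_mul_sinh (t := x / c)
    (by rwa [abs_div, abs_of_pos hc, div_le_one hc]) (l * c)
  rwa [show x / c * (l * c) = l * x by field_simp] at this

/-- Hoeffding's lemma for a finite law. -/
theorem sum_mul_exp_le {p : α → ℝ} (hp : ∀ a, 0 ≤ p a) (hp1 : ∑ a, p a = 1) {X : α → ℝ}
    {c l : ℝ} (hX : ∀ a, |X a| ≤ c) (h0 : ∑ a, p a * X a = 0) :
    ∑ a, p a * Real.exp (l * X a) ≤ Real.exp (l ^ 2 * c ^ 2 / 2) := by
  rcases le_or_gt c 0 with hc | hc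
  · have hX0 : ∀ a, X a = 0 := fun a => abs_nonpos_iff.1 ((hX a).trans hc)
    simp only [hX0, mul_zero, Real.exp_zero, mul_one, hp1]
    exact Real.one_le_exp (by positivity)
  · calc ∑ a, p a * Real.exp (l * X a)
        ≤ ∑ a, p a * (Real.cosh (l * c) + X a / c * Real.sinh (l * c)) :=
          Finset.sum_le_sum fun a _ =>
            mul_le_mul_of_nonneg_left (exp_mul_le_chord hc (hX a)) (hp a)
      _ = (∑ a, p a) * Real.cosh (l * c) + (∑ a, p a * X a) * (Real.sinh (l * c) / c) := by
          rw [Finset.sum_mul, Finset.sum_mul, ← Finset.sum_add_distrib]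
          exact Finset.sum_congr rfl fun a _ => by ring
      _ = Real.cosh (l * c) := by rw [hp1, h0]; ring
      _ ≤ Real.exp (l ^ 2 * c ^ 2 / 2) := by
          have := Real.cosh_le_exp_half_sq (l * c)
          rwa [mul_pow] at this

theorem coordAvg_mono (hP : IsLaw P) (i : ι) {f g : (ι → α) → ℝ} (h : ∀ ω, f ω ≤ g ω)
    (ω : ι → α) : coordAvg P i f ω ≤ coordAvg P i g ω :=
  Finset.sum_le_sum fun a _ => mul_le_mul_of_nonneg_left (h _) (hP.nonneg i a)

theorem listAvg_exp_le (hP : IsLaw P) (l : List ι) {c : ι → ℝ} {f : (ι → α) → ℝ}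
    (hf : ∀ i ω a b, |f (Function.update ω i a) - f (Function.update ω i b)| ≤ c i) (s : ℝ)
    (ω : ι → α) :
    listAvg P l (fun ω => Real.exp (s * (f ω - listAvg P l f ω))) ω
      ≤ Real.exp (s ^ 2 / 2 * (l.map fun i => c i ^ 2).sum) := by
  induction l generalizing ω with
  | nil => simp [listAvg]
  | cons i l ih =>
    set h := listAvg P l f with hh
    change coordAvg P i (listAvg P l fun ω => Real.exp (s * (f ω - coordAvg P i h ω))) ω ≤ _
    have hi : ∀ j ∈ l, ∀ ω a, h (Function.update ω j a) = h ω := fun j hj ω a =>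
      listAvg_update f hj ω a
    have e : (fun ω => Real.exp (s * (f ω - coordAvg P i h ω)))
        = fun ω => Real.exp (s * (f ω - h ω)) * Real.exp (s * (h ω - coordAvg P i h ω)) := by
      funext ω
      rw [← Real.exp_add]
      ring_nf
    rw [e]
    have e2 := fun ω => listAvg_mul (P := P) (l := l) (f := fun ω => Real.exp (s * (f ω - h ω)))
      (g := fun ω => Real.exp (s * (h ω - coordAvg P i h ω)))
      (fun j hj ω a => by
        rw [hi j hj, coordAvg_congr_update i j (hi j hj)]) ω
    have h3 : ∀ ω, listAvg P l (fun ω => Real.exp (s * (f ω - h ω))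
          * Real.exp (s * (h ω - coordAvg P i h ω))) ω
        ≤ Real.exp (s ^ 2 / 2 * (l.map fun i => c i ^ 2).sum)
          * Real.exp (s * (h ω - coordAvg P i h ω)) := fun ω => by
      rw [e2]
      exact mul_le_mul_of_nonneg_right (ih ω) (Real.exp_pos _).le
    refine (coordAvg_mono hP i h3 ω).trans ?_
    simp only [coordAvg, Function.update_idem]
    have hd := listAvg_abs_sub_le hP l i (hf i) ω
    have key := sum_mul_exp_le (l := s) (c := c i) (hP.nonneg i) (hP.sum_eq_one i)
      (X := fun a => h (Function.update ω i a) - ∑ x, P i x * h (Function.update ω i x)) (by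
        intro a
        have : h (Function.update ω i a) - ∑ x, P i x * h (Function.update ω i x)
            = ∑ x, P i x * (h (Function.update ω i a) - h (Function.update ω i x)) := by
          simp only [mul_sub, Finset.sum_sub_distrib, ← Finset.sum_mul, hP.sum_eq_one, one_mul]
        rw [this]
        refine (Finset.abs_sum_le_sum_abs _ _).trans ?_
        calc _ ≤ ∑ x, P i x * c i := by
              refine Finset.sum_le_sum fun x _ => ?_
              rw [abs_mul, abs_of_nonneg (hP.nonneg i x)]
              exact mul_le_mul_of_nonneg_left (hd a x) (hP.nonneg i x)
          _ = c i := by rw [← Finset.sum_mul, hP.sum_eq_one, one_mul]) (by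
        simp only [mul_sub, Finset.sum_sub_distrib, ← Finset.sum_mul, hP.sum_eq_one, one_mul,
          sub_self])
    calc _ = Real.exp (s ^ 2 / 2 * (l.map fun i => c i ^ 2).sum)
          * ∑ a, P i a * Real.exp (s * (h (Function.update ω i a)
            - ∑ x, P i x * h (Function.update ω i x))) := by
          rw [Finset.mul_sum]
          exact Finset.sum_congr rfl fun a _ => by ring
      _ ≤ Real.exp (s ^ 2 / 2 * (l.map fun i => c i ^ 2).sum) * Real.exp (s ^ 2 * c i ^ 2 / 2) :=
          mul_le_mul_of_nonneg_left key (Real.exp_pos _).le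
      _ = _ := by
          rw [← Real.exp_add, List.map_cons, List.sum_cons]
          ring_nf

theorem prodExp_listAvg (hP : IsLaw P) (l : List ι) (f : (ι → α) → ℝ) :
    prodExp P (listAvg P l f) = prodExp P f := by
  induction l with
  | nil => rfl
  | cons i l ih => exact (prodExp_coordAvg hP i _).trans ih

omit [Fintype α] in
theorem eq_of_forall_update [Nonempty ι] {f : (ι → α) → ℝ}
    (hf : ∀ i ω a, f (Function.update ω i a) = f ω) (ω ω' : ι → α) : f ω = f ω' := by
  have : ∀ s : Finset ι, f (fun i => if i ∈ s then ω' i else ω i) = f ω := by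
    intro s
    induction s using Finset.induction_on with
    | empty => simp
    | insert i s _ ih =>
      rw [← ih, ← hf i (fun i => if i ∈ s then ω' i else ω i) (ω' i)]
      congr 1
      funext j
      by_cases h : j = i
      · subst h; simp
      · simp [h]
  simpa using (this Finset.univ).symm

theorem listAvg_univ (hP : IsLaw P) (f : (ι → α) → ℝ) (ω : ι → α) :
    listAvg P Finset.univ.toList f ω = prodExp P f := by
  rcases isEmpty_or_nonempty ι with h | h
  · simp [listAvg, prodExp, Subsingleton.elim ω default]
  · rw [← prodExp_listAvg hP Finset.univ.toList f, ← prodExp_const hP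
      (listAvg P Finset.univ.toList f ω)]
    congr 1
    funext ω'
    exact eq_of_forall_update (fun i ω a => listAvg_update f (by simp) ω a) _ _

theorem prodExp_exp_le (hP : IsLaw P) {c : ι → ℝ} {f : (ι → α) → ℝ}
    (hf : ∀ i ω a b, |f (Function.update ω i a) - f (Function.update ω i b)| ≤ c i) (s : ℝ) :
    prodExp P (fun ω => Real.exp (s * (f ω - prodExp P f)))
      ≤ Real.exp (s ^ 2 / 2 * ∑ i, c i ^ 2) := by
  rw [← prodExp_listAvg hP Finset.univ.toList, ← prodExp_const hP (Real.exp _)]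
  refine prodExp_mono hP fun ω => ?_
  have := listAvg_exp_le hP Finset.univ.toList hf s ω
  simp only [listAvg_univ hP] at this ⊢
  simpa using this

/-- The probability of an event. -/
noncomputable def prodProb (P : ι → α → ℝ) (A : Set (ι → α)) : ℝ :=
  prodExp P (A.indicator 1)

theorem prodProb_mono (hP : IsLaw P) {A B : Set (ι → α)} (h : A ⊆ B) :
    prodProb P A ≤ prodProb P B :=
  prodExp_mono hP fun ω => Set.indicator_le_indicator_of_subset h (fun _ => zero_le_one) ω

theorem prodProb_union_le (hP : IsLaw P) (A B : Set (ι → α)) :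
    prodProb P (A ∪ B) ≤ prodProb P A + prodProb P B := by
  rw [prodProb, prodProb, prodProb, ← prodExp_add]
  refine prodExp_mono hP fun ω => ?_
  by_cases h1 : ω ∈ A <;> by_cases h2 : ω ∈ B <;> simp [h1, h2]

theorem prodProb_iUnion_le {κ : Type} [Fintype κ] (hP : IsLaw P) (A : κ → Set (ι → α)) :
    prodProb P (⋃ k, A k) ≤ ∑ k, prodProb P (A k) := by
  simp only [prodProb]
  rw [← prodExp_sum]
  refine prodExp_mono hP fun ω => ?_
  have h0 : ∀ k, 0 ≤ (A k).indicator (1 : (ι → α) → ℝ) ω := fun k =>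
    Set.indicator_nonneg (fun _ _ => zero_le_one) ω
  by_cases h : ω ∈ ⋃ k, A k
  · obtain ⟨k, hk⟩ := Set.mem_iUnion.1 h
    rw [Set.indicator_of_mem h]
    refine le_trans ?_ (Finset.single_le_sum (fun k _ => h0 k) (Finset.mem_univ k))
    rw [Set.indicator_of_mem hk]
  · rw [Set.indicator_of_notMem h]
    exact Finset.sum_nonneg fun k _ => h0 k

/-- McDiarmid's inequality (with a non-optimal constant). -/
theorem prodProb_ge_le (hP : IsLaw P) {c : ι → ℝ} {f : (ι → α) → ℝ}
    (hf : ∀ i ω a b, |f (Function.update ω i a) - f (Function.update ω i b)| ≤ c i) {t V : ℝ}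
    (hV : 0 < V) (hcV : ∑ i, c i ^ 2 ≤ V) (ht : 0 ≤ t) :
    prodProb P {ω | prodExp P f + t ≤ f ω} ≤ Real.exp (-(t ^ 2 / (2 * V))) := by
  have h1 : prodProb P {ω | prodExp P f + t ≤ f ω}
      ≤ prodExp P (fun ω => Real.exp (-(t / V * t)) *
          Real.exp (t / V * (f ω - prodExp P f))) := by
    refine prodExp_mono hP fun ω => ?_
    by_cases h : prodExp P f + t ≤ f ω
    · rw [Set.indicator_of_mem (by exact h), ← Real.exp_add]
      refine Real.one_le_exp ?_
      have : 0 ≤ t / V := by positivity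
      nlinarith
    · rw [Set.indicator_of_notMem (by exact h)]
      positivity
  refine h1.trans ?_
  rw [prodExp_mul_left]
  refine (mul_le_mul_of_nonneg_left (prodExp_exp_le hP hf _) (Real.exp_pos _).le).trans ?_
  rw [← Real.exp_add]
  refine Real.exp_le_exp.2 ?_
  have : (t / V) ^ 2 / 2 * ∑ i, c i ^ 2 ≤ (t / V) ^ 2 / 2 * V := by gcongr
  refine (add_le_add_right this _).trans (le_of_eq ?_)
  field_simp
  ring

/-- A bound for the second moment of a function with bounded differences. -/
theorem prodExp_sq_le (hP : IsLaw P) {c : ι → ℝ} {f : (ι → α) → ℝ}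
    (hf : ∀ i ω a b, |f (Function.update ω i a) - f (Function.update ω i b)| ≤ c i)
    (h0 : prodExp P f = 0) :
    prodExp P (fun ω => f ω ^ 2) ≤ 4 * ∑ i, c i ^ 2 := by
  have key : ∀ s : ℝ, s ^ 2 * prodExp P (fun ω => f ω ^ 2)
      ≤ 4 * (Real.exp (s ^ 2 / 2 * ∑ i, c i ^ 2) - 1) := by
    intro s
    have h1 := prodExp_exp_le hP hf s
    have h2 := prodExp_exp_le hP hf (-s)
    simp only [h0, sub_zero, neg_sq] at h1 h2
    have h3 : prodExp P (fun ω => s ^ 2 * f ω ^ 2)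
        ≤ prodExp P (fun ω => 2 * (Real.exp (s * f ω) + Real.exp (-s * f ω)) + (-4)) := by
      refine prodExp_mono hP fun ω => ?_
      have e : -s * f ω = -(s * f ω) := by ring
      rw [e, ← mul_pow]
      generalize s * f ω = x
      rcases le_total 0 x with hx | hx
      · linarith [Real.quadratic_le_exp_of_nonneg hx, Real.add_one_le_exp (-x)]
      · have := Real.quadratic_le_exp_of_nonneg (neg_nonneg.2 hx)
        rw [neg_sq] at this
        linarith [Real.add_one_le_exp x]
    rw [prodExp_mul_left, prodExp_add, prodExp_mul_left, prodExp_add, prodExp_const hP] at h3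
    linarith
  set S := ∑ i, c i ^ 2
  have hS : 0 ≤ S := Finset.sum_nonneg fun i _ => sq_nonneg _
  have hexp : Real.exp (1 / 2) ≤ 2 := by
    have := Real.exp_one_lt_d9
    have h : Real.exp (1 / 2) * Real.exp (1 / 2) = Real.exp 1 := by
      rw [← Real.exp_add]; norm_num
    nlinarith [Real.exp_pos (1 / 2 : ℝ)]
  refine le_of_forall_pos_le_add fun η hη => ?_
  have hpos : 0 < S + η / 4 := by positivity
  have := key (1 / Real.sqrt (S + η / 4))
  rw [div_pow, Real.sq_sqrt hpos.le, one_pow] at this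
  have h5 : 1 / (S + η / 4) / 2 * S ≤ 1 / 2 := by
    rw [div_div, div_mul_eq_mul_div, div_le_div_iff₀ (by positivity) (by norm_num)]
    nlinarith
  have h6 := Real.exp_le_exp.2 h5
  rw [div_mul_eq_mul_div, one_mul, div_le_iff₀ hpos] at this
  nlinarith

/-- If for every choice of the other coordinates an event has probability at most `δ`, so has it in
total. -/
theorem prodProb_le_of_coord (hP : IsLaw P) (i : ι) {A : Set (ι → α)} {δ : ℝ}
    (h : ∀ ω, ∑ a, P i a * A.indicator 1 (Function.update ω i a) ≤ δ) : prodProb P A ≤ δ := by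
  rw [prodProb, ← prodExp_coordAvg hP i, ← prodExp_const hP δ]
  exact prodExp_mono hP h

end ProductExpectation

/-! ### Sums over edges -/

section EdgeSums

variable {V : Type} [Fintype V] [DecidableEq V] (G : SimpleGraph V) [DecidableRel G.Adj]

theorem sum_incidenceFinset (x : Sym2 V → ℝ) (v : V) :
    ∑ e ∈ G.incidenceFinset v, x e = ∑ u ∈ G.neighborFinset v, x s(v, u) := by
  symm
  refine Finset.sum_bij (fun u _ => s(v, u)) ?_ ?_ ?_ fun _ _ => rfl
  · intro u hu
    rw [SimpleGraph.mem_incidenceFinset]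
    exact ⟨(SimpleGraph.mem_neighborFinset _ _ _).1 hu, Sym2.mem_mk_left v u⟩
  · intro u _ u' _ h
    exact Sym2.congr_right.1 h
  · intro e he
    rw [SimpleGraph.mem_incidenceFinset] at he
    obtain ⟨u, rfl⟩ := Sym2.mem_iff_exists.1 he.2
    exact ⟨u, (SimpleGraph.mem_neighborFinset _ _ _).2 he.1, rfl⟩

theorem sum_sum_incidenceFinset (x : Sym2 V → ℝ) :
    ∑ v, ∑ e ∈ G.incidenceFinset v, x e = 2 * fractionalSize G x := by
  have h : ∀ v, ∑ e ∈ G.incidenceFinset v, x e = ∑ e ∈ G.edgeFinset, if v ∈ e then x e else 0 := by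
    intro v
    rw [← Finset.sum_filter]
    congr 1
    ext e
    simp [SimpleGraph.mem_incidenceFinset, SimpleGraph.incidenceSet]
  simp only [h]
  rw [Finset.sum_comm, fractionalSize, Finset.mul_sum]
  refine Finset.sum_congr rfl fun e he => ?_
  induction e with
  | h u v =>
    have huv : u ≠ v := (SimpleGraph.mem_edgeFinset.1 he : G.Adj u v).ne
    rw [← Finset.sum_filter, Finset.sum_const, nsmul_eq_mul]
    have : (Finset.univ.filter fun w => w ∈ s(u, v)) = {u, v} := by
      ext w
      simp
    rw [this, Finset.card_pair huv]
    norm_num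

/-- Weak duality: the size of a vertex cover bounds the size of every fractional matching. -/
theorem maxFractionalMatching_le_card (C : Finset V)
    (hC : ∀ u v, G.Adj u v → u ∈ C ∨ v ∈ C) : maxFractionalMatching G ≤ C.card := by
  refine csSup_le (fractionalSizes_nonempty G) ?_
  rintro _ ⟨x, hx, rfl⟩
  calc fractionalSize G x ≤ ∑ e ∈ G.edgeFinset, ∑ v ∈ C, if v ∈ e then x e else 0 := by
        refine Finset.sum_le_sum fun e he => ?_
        have h0 : ∀ v ∈ C, 0 ≤ if v ∈ e then x e else 0 := fun v _ => by
          split_ifs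
          exacts [hx.nonneg e, le_rfl]
        induction e with
        | h u v =>
          rcases hC u v (SimpleGraph.mem_edgeFinset.1 he) with h | h
          · exact le_trans (by simp) (Finset.single_le_sum h0 h)
          · exact le_trans (by simp) (Finset.single_le_sum h0 h)
    _ = ∑ v ∈ C, ∑ e ∈ G.incidenceFinset v, x e := by
        rw [Finset.sum_comm]
        refine Finset.sum_congr rfl fun v _ => ?_
        rw [← Finset.sum_filter]
        congr 1
        ext e
        simp [SimpleGraph.mem_incidenceFinset, SimpleGraph.incidenceSet]
    _ ≤ ∑ v ∈ C, 1 := Finset.sum_le_sum fun v _ => hx.sum_le_one v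
    _ = C.card := by simp

theorem sum_neighborFinset_comm (f : V → V → ℝ) :
    ∑ v, ∑ u ∈ G.neighborFinset v, f v u = ∑ u, ∑ v ∈ G.neighborFinset u, f v u := by
  refine Finset.sum_comm' fun v u => ?_
  simp [SimpleGraph.adj_comm]

end EdgeSums

/-! ### The level process -/

section Level

variable {V : Type} [Fintype V] [DecidableEq V] (G : SimpleGraph V) [DecidableRel G.Adj]

/-- Every node has a level, which starts at `0` and increases by one in every step until the node
is frozen. An edge has weight `w i` if `i` is the smaller of the levels of its endpoints. A node is
frozen when the estimate of the weight of its edges, in which neighbour `u` counts with the factor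
`θ j u`, reaches the threshold `a`. -/
noncomputable def level (w : ℕ → ℝ) (a : ℝ) (θ : ℕ → V → ℝ) : ℕ → V → ℕ
  | 0 => fun _ => 0
  | j + 1 => fun v =>
    if level w a θ j v = j ∧ ∑ u ∈ G.neighborFinset v, θ j u * w (level w a θ j u) < a then j + 1
    else level w a θ j v

/-- The weight of all edges of a node, if the nodes have levels `t`. -/
def load (w : ℕ → ℝ) (t : V → ℕ) (v : V) : ℝ :=
  ∑ u ∈ G.neighborFinset v, w (min (t u) (t v))

/-- The error of the estimate of the load in which neighbour `u` counts with the factor `η u`. -/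
def deviation (w : ℕ → ℝ) (t : V → ℕ) (η : V → ℝ) (v : V) : ℝ :=
  ∑ u ∈ G.neighborFinset v, (η u - 1) * w (min (t u) (t v))

/-- The penalty for an estimate with error `s`. -/
noncomputable def excess (ε s : ℝ) : ℝ := max 0 (2 * |s| / ε - 1)

/-- The edge weights given by levels `t`, with the edges of overloaded nodes removed. -/
noncomputable def prunedWeights (w : ℕ → ℝ) (t : V → ℕ) : Sym2 V → ℝ :=
  Sym2.lift ⟨fun u v => if G.Adj u v ∧ load G w t u ≤ 1 ∧ load G w t v ≤ 1 then
    w (min (t u) (t v)) else 0, fun u v => by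
      simp only [G.adj_comm u v, and_comm (a := load G w t u ≤ 1), min_comm (t u)]⟩

variable {G} {w : ℕ → ℝ} {a : ℝ} {θ : ℕ → V → ℝ}

theorem level_succ_cases (j : ℕ) (v : V) :
    (level G w a θ (j + 1) v = j + 1 ∧ level G w a θ j v = j ∧
      ∑ u ∈ G.neighborFinset v, θ j u * w (level G w a θ j u) < a) ∨
    (level G w a θ (j + 1) v = level G w a θ j v ∧ (level G w a θ j v = j →
      a ≤ ∑ u ∈ G.neighborFinset v, θ j u * w (level G w a θ j u))) := by
  by_cases h : level G w a θ j v = j ∧ ∑ u ∈ G.neighborFinset v, θ j u * w (level G w a θ j u) < a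
  · exact Or.inl ⟨by rw [level]; exact if_pos h, h⟩
  · exact Or.inr ⟨by rw [level]; exact if_neg h, fun h' => not_lt.1 fun h'' => h ⟨h', h''⟩⟩

theorem level_le (j : ℕ) (v : V) : level G w a θ j v ≤ j := by
  induction j with
  | zero => exact le_rfl
  | succ j ih => rcases level_succ_cases (G := G) (w := w) (a := a) (θ := θ) j v with h | h <;> omega

theorem level_eq_min {i j : ℕ} (h : i ≤ j) (v : V) :
    level G w a θ i v = min i (level G w a θ j v) := by
  induction j, h using Nat.le_induction with
  | base => exact (min_eq_right (level_le i v)).symm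
  | succ j hj ih =>
    have := level_le (G := G) (w := w) (a := a) (θ := θ) j v
    rcases level_succ_cases (G := G) (w := w) (a := a) (θ := θ) j v with h | h <;> omega

theorem level_mono {i j : ℕ} (h : i ≤ j) (v : V) : level G w a θ i v ≤ level G w a θ j v := by
  rw [level_eq_min h]
  exact min_le_right _ _

theorem load_mono (hw : Monotone w) {t t' : V → ℕ} (h : ∀ v, t v ≤ t' v) (v : V) :
    load G w t v ≤ load G w t' v :=
  Finset.sum_le_sum fun u _ => hw (min_le_min (h u) (h v))

theorem load_nonneg (hw : ∀ i, 0 < w i) (t : V → ℕ) (v : V) : 0 ≤ load G w t v :=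
  Finset.sum_nonneg fun _ _ => (hw _).le

theorem estimate_eq {j : ℕ} {v : V} (h : level G w a θ j v = j) :
    ∑ u ∈ G.neighborFinset v, θ j u * w (level G w a θ j u)
      = load G w (level G w a θ j) v + deviation G w (level G w a θ j) (θ j) v := by
  rw [load, deviation, ← Finset.sum_add_distrib]
  refine Finset.sum_congr rfl fun u _ => ?_
  rw [h, min_eq_left (level_le j u)]
  ring

/-- A node whose level is not `0` was not frozen in the step before it reached its level, and
its load has hardly increased since. -/
theorem level_eq_zero_or {ε : ℝ} (hε : 0 < ε) (hw : ∀ i, 0 < w i)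
    (hstep : ∀ i, w (i + 1) ≤ (1 + ε) * w i) (j : ℕ) (v : V) :
    level G w a θ j v = 0 ∨ ∃ i < j, level G w a θ i v = i ∧
      load G w (level G w a θ i) v + deviation G w (level G w a θ i) (θ i) v < a ∧
      load G w (level G w a θ j) v ≤ (1 + ε) * load G w (level G w a θ i) v := by
  rcases Nat.eq_zero_or_pos (level G w a θ j v) with h | h
  · exact Or.inl h
  · obtain ⟨i, hi⟩ : ∃ i, level G w a θ j v = i + 1 := ⟨_, (Nat.succ_pred_eq_of_pos h).symm⟩
    have hij : i + 1 ≤ j := hi ▸ level_le j v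
    have h1 : level G w a θ (i + 1) v = i + 1 := by rw [level_eq_min hij, hi, min_self]
    have h2 : level G w a θ i v = i := by rw [level_eq_min (by omega : i ≤ j), hi]; omega
    refine Or.inr ⟨i, by omega, h2, ?_, ?_⟩
    · rcases level_succ_cases (G := G) (w := w) (a := a) (θ := θ) i v with h | h
      · rw [← estimate_eq h2]
        exact h.2.2
      · omega
    · rw [load, load, Finset.mul_sum]
      refine Finset.sum_le_sum fun u _ => ?_
      rw [hi, h2, level_eq_min (by omega : i ≤ j) u]
      generalize level G w a θ j u = s
      rcases Nat.lt_or_ge i s with hs | hs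
      · rw [min_eq_right (by omega : i + 1 ≤ s), min_eq_left hs.le, min_self]
        exact hstep i
      · rw [min_eq_left (by omega : s ≤ i + 1), min_eq_right hs, min_eq_left hs]
        nlinarith [hw s]

theorem load_level_zero_le {D : ℕ} (hw1 : w 0 * D ≤ 1) (hw : ∀ i, 0 < w i)
    (hD : G.maxDegree ≤ D) {t : V → ℕ} {v : V} (hv : t v = 0) : load G w t v ≤ 1 := by
  have h1 : load G w t v = G.degree v * w 0 := by
    simp [load, hv]
  have h2 : (G.degree v : ℝ) ≤ D := by exact_mod_cast (G.degree_le_maxDegree v).trans hD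
  rw [h1]
  nlinarith [hw 0]

theorem excess_nonneg (ε s : ℝ) : 0 ≤ excess ε s := le_max_left _ _

theorem isFractionalMatching_prunedWeights (hw : ∀ i, 0 < w i) (t : V → ℕ) :
    IsFractionalMatching G (prunedWeights G w t) := by
  refine ⟨fun e => ?_, fun e he => ?_, fun v => ?_⟩
  · induction e with
    | h u v =>
      simp only [prunedWeights, Sym2.lift_mk]
      split_ifs
      exacts [(hw _).le, le_rfl]
  · induction e with
    | h u v =>
      simp only [prunedWeights, Sym2.lift_mk]
      exact if_neg fun h => he h.1
  · rw [sum_incidenceFinset]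
    simp only [prunedWeights, Sym2.lift_mk]
    by_cases hv : load G w t v ≤ 1
    · refine le_trans (Finset.sum_le_sum fun u _ => ?_) hv
      rw [min_comm (t u)]
      split_ifs
      exacts [le_rfl, (hw _).le]
    · simp [hv]

theorem sum_load_sub_le (hw : ∀ i, 0 < w i) (t : V → ℕ) :
    ∑ v, load G w t v - 2 * ∑ v, (if load G w t v ≤ 1 then 0 else load G w t v)
      ≤ 2 * fractionalSize G (prunedWeights G w t) := by
  set o : V → ℝ := fun v => if load G w t v ≤ 1 then 0 else 1 with ho
  have h1 : ∑ v, (if load G w t v ≤ 1 then 0 else load G w t v)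
      = ∑ v, ∑ u ∈ G.neighborFinset v, o v * w (min (t v) (t u)) := by
    refine Finset.sum_congr rfl fun v _ => ?_
    rw [← Finset.mul_sum]
    simp only [ho, min_comm (t v)]
    change _ = _ * load G w t v
    split_ifs <;> simp
  have h2 : ∑ v, ∑ u ∈ G.neighborFinset v, o v * w (min (t v) (t u))
      = ∑ v, ∑ u ∈ G.neighborFinset v, o u * w (min (t v) (t u)) := by
    rw [sum_neighborFinset_comm]
    simp only [min_comm]
  have h3 : ∑ v, load G w t v = ∑ v, ∑ u ∈ G.neighborFinset v, w (min (t v) (t u)) := by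
    simp only [load, min_comm]
  rw [← sum_sum_incidenceFinset, two_mul]
  nth_rw 2 [h1]
  rw [h1, h2, h3, ← sub_sub]
  rw [← h2, ← Finset.sum_sub_distrib, h2, ← Finset.sum_sub_distrib]
  refine Finset.sum_le_sum fun v _ => ?_
  rw [sum_incidenceFinset, ← Finset.sum_sub_distrib, ← Finset.sum_sub_distrib]
  refine Finset.sum_le_sum fun u hu => ?_
  have hadj : G.Adj v u := (SimpleGraph.mem_neighborFinset _ _ _).1 hu
  have := hw (min (t v) (t u))
  simp only [prunedWeights, Sym2.lift_mk, ho, hadj, true_and]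
  split_ifs <;> first | linarith | tauto

/-- If the total penalty of the estimates is small, then the pruned weights are nearly a
`2`-approximation. -/
theorem maxFractionalMatching_le_of_excess {ε : ℝ} (hε : 0 < ε) (hε' : ε ≤ 1 / 1000) {D L : ℕ}
    (hw : ∀ i, 0 < w i) (hmono : Monotone w) (hstep : ∀ i, w (i + 1) ≤ (1 + ε) * w i)
    (hwL : w L = 1) (hw1 : w 0 * D ≤ 1) (hD : G.maxDegree ≤ D)
    (hex : ∑ j ∈ Finset.range L, ∑ v,
        excess ε (deviation G w (level G w (1 - 2 * ε) θ j) (θ j) v)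
      ≤ 2 * ε * ∑ v, load G w (level G w (1 - 2 * ε) θ L) v + ε * maxFractionalMatching G) :
    maxFractionalMatching G
      ≤ (2 + 100 * ε) * fractionalSize G (prunedWeights G w (level G w (1 - 2 * ε) θ L)) := by
  set lv := level G w (1 - 2 * ε) θ with hlv
  set m := maxFractionalMatching G
  set S := ∑ v, load G w (lv L) v with hS
  set pen : ℕ → V → ℝ := fun j v => excess ε (deviation G w (lv j) (θ j) v) with hpen
  set B := ∑ j ∈ Finset.range L, ∑ v, pen j v with hB
  have hpen0 : ∀ j v, 0 ≤ pen j v := fun j v => excess_nonneg _ _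
  have hsingle : ∀ v, ∀ j < L, pen j v ≤ ∑ j ∈ Finset.range L, pen j v := fun v j hj =>
    Finset.single_le_sum (f := fun j => pen j v) (fun j _ => hpen0 j v) (Finset.mem_range.2 hj)
  have hB' : B = ∑ v, ∑ j ∈ Finset.range L, pen j v := Finset.sum_comm
  have hpen_ge : ∀ j v, 2 * |deviation G w (lv j) (θ j) v| / ε - 1 ≤ pen j v := fun j v =>
    le_max_right _ _
  -- overloaded nodes
  have hover : ∑ v, (if load G w (lv L) v ≤ 1 then 0 else load G w (lv L) v) ≤ 2 * B := by
    rw [hB', Finset.mul_sum]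
    refine Finset.sum_le_sum fun v _ => ?_
    have hp : 0 ≤ ∑ j ∈ Finset.range L, pen j v := Finset.sum_nonneg fun j _ => hpen0 j v
    split_ifs with h
    · positivity
    · push Not at h
      rcases level_eq_zero_or (G := G) (θ := θ) (a := 1 - 2 * ε) hε hw hstep L v with h0 | h0
      · exact absurd (load_level_zero_le hw1 hw hD h0) (not_le.2 h)
      · obtain ⟨i, hiL, -, hest, hload⟩ := h0
        rw [← hlv] at hest hload
        have h1 := (hpen_ge i v).trans (hsingle v i hiL)
        set y := load G w (lv i) v
        set s := deviation G w (lv i) (θ i) v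
        have hs : y - 1 + 2 * ε ≤ |s| := by linarith [neg_le_abs s]
        have hy : 1 - ε ≤ y := by
          by_contra hy
          push Not at hy
          nlinarith
        have h2 : 2 * (y - 1 + 2 * ε) / ε ≤ 2 * |s| / ε := by gcongr
        have h3 : 2 * (y - 1 + 2 * ε) / ε = 2 * ((y - 1) / ε) + 4 := by
          field_simp
          ring
        have h4 : y ≤ 2 * ((y - 1) / ε) + 3 := by
          have e : y = 1 + ε * ((y - 1) / ε) := by field_simp; ring
          have : -1 ≤ (y - 1) / ε := by rw [le_div_iff₀ hε]; linarith
          nlinarith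
        have hy0 : 0 ≤ y := by linarith
        nlinarith
  -- nodes that are frozen too early
  set C : Finset V := Finset.univ.filter fun v => lv L v < L ∨ 1 ≤ load G w (lv L) v with hC
  have hcov : ∀ u v, G.Adj u v → u ∈ C ∨ v ∈ C := by
    intro u v huv
    by_contra h
    simp only [hC, Finset.mem_filter, Finset.mem_univ, true_and, not_or, not_lt, not_le] at h
    have hu : lv L u = L := le_antisymm (level_le L u) h.1.1
    have hv : lv L v = L := le_antisymm (level_le L v) h.2.1
    have : w (min (lv L v) (lv L u)) ≤ load G w (lv L) u :=
      Finset.single_le_sum (f := fun x => w (min (lv L x) (lv L u))) (fun x _ => (hw _).le)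
        ((SimpleGraph.mem_neighborFinset _ _ _).2 huv)
    rw [hu, hv, min_self, hwL] at this
    linarith [h.1.2]
  have hmC : m ≤ C.card := maxFractionalMatching_le_card G C hcov
  have hCS : (1 - 3 * ε) * C.card ≤ B + S := by
    have h1 : ((1 - 3 * ε) * C.card : ℝ)
        ≤ ∑ v ∈ C, ((∑ j ∈ Finset.range L, pen j v) + load G w (lv L) v) := by
      rw [mul_comm, ← nsmul_eq_mul]
      refine Finset.card_nsmul_le_sum _ _ _ fun v hv => ?_
      have hp : 0 ≤ ∑ j ∈ Finset.range L, pen j v := Finset.sum_nonneg fun j _ => hpen0 j v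
      rcases (Finset.mem_filter.1 hv).2 with h | h
      · by_cases hy : 1 - 3 * ε ≤ load G w (lv L) v
        · linarith
        · push Not at hy
          set j := lv L v with hj
          have hjj : lv j v = j := by
            rw [hlv, level_eq_min h.le, ← hlv, ← hj, min_self]
          have hj1 : lv (j + 1) v = j := by
            rw [hlv, level_eq_min (by omega : j + 1 ≤ L), ← hlv, ← hj]
            omega
          have hest : 1 - 2 * ε ≤ load G w (lv j) v + deviation G w (lv j) (θ j) v := by
            rw [hlv, ← estimate_eq hjj]
            rcases level_succ_cases (G := G) (w := w) (a := 1 - 2 * ε) (θ := θ) j v with h | h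
            · rw [← hlv] at h
              omega
            · exact h.2 hjj
          have hlm : load G w (lv j) v ≤ load G w (lv L) v :=
            load_mono hmono (fun u => level_mono h.le u) v
          have hs : ε ≤ |deviation G w (lv j) (θ j) v| :=
            le_trans (by linarith) (le_abs_self _)
          have h2 : 1 ≤ |deviation G w (lv j) (θ j) v| / ε := by
            rwa [le_div_iff₀ hε, one_mul]
          have h3 := (hpen_ge j v).trans (hsingle v j h)
          have h4 := load_nonneg (G := G) hw (lv L) v
          rw [mul_div_assoc] at h3
          linarith
      · linarith
    refine h1.trans ?_
    rw [hB', hS, ← Finset.sum_add_distrib]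
    refine Finset.sum_le_sum_of_subset_of_nonneg (Finset.subset_univ _) fun v _ _ => ?_
    exact add_nonneg (Finset.sum_nonneg fun j _ => hpen0 j v) (load_nonneg hw _ v)
  have hX := sum_load_sub_le (G := G) hw (lv L)
  rw [← hS] at hX
  have hS0 : 0 ≤ S := Finset.sum_nonneg fun v _ => load_nonneg hw _ v
  set X := fractionalSize G (prunedWeights G w (lv L))
  have e1 : (1 - 3 * ε) * m ≤ (1 - 3 * ε) * C.card := by
    refine mul_le_mul_of_nonneg_left hmC (by linarith)
  have e2 : (1 - 4 * ε) * m ≤ (1 + 2 * ε) * S := by linarith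
  have e3 : S * (1 - 8 * ε) - 4 * (ε * m) ≤ 2 * X := by linarith
  have e4 : m ≤ (1 + 7 * ε) * S := by
    have : (1 + 2 * ε) ≤ (1 - 4 * ε) * (1 + 7 * ε) := by nlinarith
    have h1 : (1 - 4 * ε) * m ≤ (1 - 4 * ε) * ((1 + 7 * ε) * S) := by nlinarith
    exact le_of_mul_le_mul_left h1 (by linarith)
  have e5 : S * (1 - 13 * ε) ≤ 2 * X := by
    have h1 : ε * m ≤ ε * ((1 + 7 * ε) * S) := mul_le_mul_of_nonneg_left e4 hε.le
    have h2 : (4 * ε * (1 + 7 * ε)) * S ≤ (5 * ε) * S :=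
      mul_le_mul_of_nonneg_right (by nlinarith) hS0
    linarith
  have hX0 : 0 ≤ X := by
    have : 0 ≤ S * (1 - 13 * ε) := mul_nonneg hS0 (by linarith)
    linarith
  have e6 : S ≤ (1 + 14 * ε) * (2 * X) := by
    have h1 : 1 ≤ (1 - 13 * ε) * (1 + 14 * ε) := by nlinarith
    have h2 := mul_le_mul_of_nonneg_right e5 (by positivity : 0 ≤ 1 + 14 * ε)
    have h3 := mul_le_mul_of_nonneg_left h1 hS0
    linarith
  have e7 : (1 + 7 * ε) * (1 + 14 * ε) ≤ 1 + 50 * ε := by nlinarith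
  calc m ≤ (1 + 7 * ε) * ((1 + 14 * ε) * (2 * X)) :=
        e4.trans (mul_le_mul_of_nonneg_left e6 (by positivity))
    _ = (1 + 7 * ε) * (1 + 14 * ε) * (2 * X) := by ring
    _ ≤ (1 + 50 * ε) * (2 * X) := mul_le_mul_of_nonneg_right e7 (by positivity)
    _ = (2 + 100 * ε) * X := by ring

end Level

/-! ### One step of the level process with random factors -/

/-- The law of a bit that is `true` with probability `p`. -/
def bernoulliLaw (p : ℝ) (b : Bool) : ℝ := if b then p else 1 - p

theorem isLaw_bernoulliLaw {ι : Type} {p : ι → ℝ} (h0 : ∀ i, 0 ≤ p i) (h1 : ∀ i, p i ≤ 1) :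
    IsLaw fun i => bernoulliLaw (p i) := by
  refine ⟨fun i b => ?_, fun i => by simp [bernoulliLaw]⟩
  cases b
  · simpa [bernoulliLaw] using h1 i
  · simpa [bernoulliLaw] using h0 i

theorem excess_le_sq (ε s : ℝ) : excess ε s ≤ 1 / ε ^ 2 * s ^ 2 := by
  have e : 1 / ε ^ 2 * s ^ 2 = (|s| / ε) ^ 2 := by rw [div_pow, sq_abs]; ring
  rw [e, excess, mul_div_assoc]
  exact max_le (sq_nonneg _) (by nlinarith [sq_nonneg (|s| / ε - 1)])

theorem abs_excess_sub_le {ε : ℝ} (hε : 0 < ε) (s s' : ℝ) :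
    |excess ε s - excess ε s'| ≤ 2 / ε * |s - s'| := by
  rw [excess, excess, max_comm 0, max_comm 0]
  refine (abs_max_sub_max_le_abs _ _ _).trans ?_
  have : 2 * |s| / ε - 1 - (2 * |s'| / ε - 1) = 2 / ε * (|s| - |s'|) := by ring
  rw [this, abs_mul, abs_of_pos (by positivity : 0 < 2 / ε)]
  exact mul_le_mul_of_nonneg_left (abs_abs_sub_abs_le _ _) (by positivity)

section Step

variable {V : Type} [Fintype V] [DecidableEq V] {G : SimpleGraph V} [DecidableRel G.Adj]
  {w : ℕ → ℝ} {t : V → ℕ} {η : V → Bool → ℝ} {p W : ℝ}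

theorem abs_deviation_sub_le (hw : ∀ i, 0 < w i) (hη : ∀ u b b', |η u b - η u b'| ≤ 1 / p)
    (v i : V) (r : V → Bool) (b b' : Bool) :
    |deviation G w t (fun u => η u (Function.update r i b u)) v
      - deviation G w t (fun u => η u (Function.update r i b' u)) v|
      ≤ if G.Adj v i then w (min (t i) (t v)) / p else 0 := by
  simp only [deviation, ← Finset.sum_sub_distrib, ← sub_mul, sub_sub_sub_cancel_right]
  refine (Finset.abs_sum_le_sum_abs _ _).trans ?_
  have h : ∀ u ∈ G.neighborFinset v,
      |(η u (Function.update r i b u) - η u (Function.update r i b' u)) * w (min (t u) (t v))|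
        ≤ if i = u then w (min (t u) (t v)) / p else 0 := by
    intro u _
    split_ifs with hu
    · subst hu
      rw [abs_mul, abs_of_pos (hw _), Function.update_self, Function.update_self, div_eq_mul_one_div,
        mul_comm]
      exact mul_le_mul_of_nonneg_left (hη _ _ _) (hw _).le
    · rw [Function.update_of_ne (Ne.symm hu), Function.update_of_ne (Ne.symm hu)]
      simp
  refine (Finset.sum_le_sum h).trans (le_of_eq ?_)
  rw [Finset.sum_ite_eq]
  simp

theorem sum_sq_weight_le (hw : ∀ i, 0 < w i) (hW : ∀ u, w (t u) ≤ W) (hmono : Monotone w)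
    (v : V) : ∑ i, (if G.Adj v i then w (min (t i) (t v)) / p else 0) ^ 2
      ≤ W / p ^ 2 * load G w t v := by
  rw [load, Finset.mul_sum, ← Finset.sum_subset (Finset.subset_univ (G.neighborFinset v))]
  · refine Finset.sum_le_sum fun u hu => ?_
    rw [if_pos ((SimpleGraph.mem_neighborFinset _ _ _).1 hu), div_pow, div_mul_eq_mul_div]
    refine div_le_div_of_nonneg_right ?_ (sq_nonneg _)
    rw [sq]
    exact mul_le_mul_of_nonneg_right ((hmono (min_le_left _ _)).trans (hW u)) (hw _).le
  · intro u _ hu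
    rw [if_neg fun h => hu ((SimpleGraph.mem_neighborFinset _ _ _).2 h)]
    norm_num

theorem prodExp_deviation (hp0 : 0 ≤ p) (hp1 : p ≤ 1)
    (hη1 : ∀ u, p * η u true + (1 - p) * η u false = 1) (v : V) :
    prodExp (fun _ : V => bernoulliLaw p)
      (fun r => deviation G w t (fun u => η u (r u)) v) = 0 := by
  have hP := isLaw_bernoulliLaw (ι := V) (p := fun _ => p) (fun _ => hp0) (fun _ => hp1)
  simp only [deviation]
  rw [prodExp_sum]
  refine Finset.sum_eq_zero fun u _ => ?_
  rw [prodExp_eval hP u (fun b => (η u b - 1) * w (min (t u) (t v)))]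
  simp only [Fintype.sum_bool, bernoulliLaw, if_true, Bool.false_eq_true, if_false]
  linear_combination w (min (t u) (t v)) * hη1 u

theorem prodProb_deviation_le (hw : ∀ i, 0 < w i) (hW : ∀ u, w (t u) ≤ W) (hmono : Monotone w)
    (hp0 : 0 < p) (hp1 : p ≤ 1) (hWp : W ≤ p ^ 2)
    (hη : ∀ u b b', |η u b - η u b'| ≤ 1 / p)
    (hη1 : ∀ u, p * η u true + (1 - p) * η u false = 1) (v : V) (hv : 0 < load G w t v) :
    prodProb (fun _ : V => bernoulliLaw p)
      {r | deviation G w t (fun u => η u (r u)) v ≤ -(load G w t v / 2)}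
      ≤ Real.exp (-(load G w t v / 8)) := by
  have hP := isLaw_bernoulliLaw (ι := V) (p := fun _ => p) (fun _ => hp0.le) (fun _ => hp1)
  have hE := prodExp_deviation (G := G) (w := w) (t := t) hp0.le hp1 hη1 v
  have hE' : prodExp (fun _ : V => bernoulliLaw p)
      (fun r => -1 * deviation G w t (fun u => η u (r u)) v) = 0 := by
    rw [prodExp_mul_left, hE, mul_zero]
  have key := prodProb_ge_le hP (f := fun r => -1 * deviation G w t (fun u => η u (r u)) v)
    (c := fun i => if G.Adj v i then w (min (t i) (t v)) / p else 0) (t := load G w t v / 2)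
    (V := load G w t v) (fun i r b b' => by
      rw [← mul_sub, abs_mul, abs_neg, abs_one, one_mul]
      exact abs_deviation_sub_le hw hη v i r b b') hv
    ((sum_sq_weight_le hw hW hmono v).trans (by
      have : W / p ^ 2 ≤ 1 := by rw [div_le_one (by positivity)]; exact hWp
      nlinarith)) (by positivity)
  rw [hE'] at key
  refine (prodProb_mono hP fun r hr => ?_).trans (key.trans (Real.exp_le_exp.2 (le_of_eq ?_)))
  · have : deviation G w t (fun u => η u (r u)) v ≤ -(load G w t v / 2) := hr
    show 0 + load G w t v / 2 ≤ -1 * deviation G w t (fun u => η u (r u)) v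
    linarith
  · field_simp
    ring

theorem prodExp_excess_le (hw : ∀ i, 0 < w i) (hW : ∀ u, w (t u) ≤ W) (hmono : Monotone w)
    (hp0 : 0 < p) (hp1 : p ≤ 1) (hη : ∀ u b b', |η u b - η u b'| ≤ 1 / p)
    (hη1 : ∀ u, p * η u true + (1 - p) * η u false = 1) {ε : ℝ} (hε : 0 < ε) :
    prodExp (fun _ : V => bernoulliLaw p)
      (fun r => ∑ v, excess ε (deviation G w t (fun u => η u (r u)) v))
      ≤ 4 * W / (p ^ 2 * ε ^ 2) * ∑ v, load G w t v := by
  have hP := isLaw_bernoulliLaw (ι := V) (p := fun _ => p) (fun _ => hp0.le) (fun _ => hp1)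
  rw [prodExp_sum, Finset.mul_sum]
  refine Finset.sum_le_sum fun v _ => ?_
  refine (prodExp_mono hP fun r => excess_le_sq ε _).trans ?_
  rw [prodExp_mul_left]
  have h1 := prodExp_sq_le hP (fun i r b b' => abs_deviation_sub_le (G := G) (t := t) hw hη v i r b b')
    (prodExp_deviation hp0.le hp1 hη1 v)
  have h2 := sum_sq_weight_le (G := G) (p := p) hw hW hmono v
  calc _ ≤ 1 / ε ^ 2 * (4 * (W / p ^ 2 * load G w t v)) :=
        mul_le_mul_of_nonneg_left (h1.trans (mul_le_mul_of_nonneg_left h2 (by norm_num)))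
          (by positivity)
    _ = _ := by field_simp

theorem prodProb_excess_le (hw : ∀ i, 0 < w i) (hW : ∀ u, w (t u) ≤ W) (hmono : Monotone w)
    (hp0 : 0 < p) (hp1 : p ≤ 1) (hη : ∀ u b b', |η u b - η u b'| ≤ 1 / p)
    (hη1 : ∀ u, p * η u true + (1 - p) * η u false = 1) {ε τ m Y : ℝ} (hε : 0 < ε) (hτ : 0 ≤ τ)
    (hm : 0 < m) (hY : 0 < Y) (hload : ∀ v, load G w t v ≤ Y) :
    prodProb (fun _ : V => bernoulliLaw p)
      {r | 4 * W / (p ^ 2 * ε ^ 2) * ∑ v, load G w t v + τ * (∑ v, load G w t v + m)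
        ≤ ∑ v, excess ε (deviation G w t (fun u => η u (r u)) v)}
      ≤ Real.exp (-(τ ^ 2 * m * ε ^ 2 * p ^ 2 / (8 * Y))) := by
  have hP := isLaw_bernoulliLaw (ι := V) (p := fun _ => p) (fun _ => hp0.le) (fun _ => hp1)
  set S := ∑ v, load G w t v with hS
  have hS0 : 0 ≤ S := Finset.sum_nonneg fun v _ => load_nonneg hw t v
  have hE := prodExp_excess_le (G := G) hw hW hmono hp0 hp1 hη hη1 hε
  rw [← hS] at hE
  have key := prodProb_ge_le hP
    (f := fun r => ∑ v, excess ε (deviation G w t (fun u => η u (r u)) v))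
    (c := fun u => 2 / ε * (load G w t u / p)) (t := τ * (S + m))
    (V := 4 * Y * (S + m) / (ε ^ 2 * p ^ 2)) (fun i r b b' => by
      rw [← Finset.sum_sub_distrib]
      refine (Finset.abs_sum_le_sum_abs _ _).trans ?_
      refine (Finset.sum_le_sum fun v _ => (abs_excess_sub_le hε _ _).trans
        (mul_le_mul_of_nonneg_left (abs_deviation_sub_le hw hη v i r b b') (by positivity))).trans
        (le_of_eq ?_)
      rw [← Finset.mul_sum, load, Finset.sum_div, ← Finset.sum_filter]
      refine congrArg _ (Finset.sum_congr ?_ fun u _ => by rw [min_comm])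
      ext u
      simp [G.adj_comm u i]) (by positivity) (by
      have : ∀ u ∈ Finset.univ, (2 / ε * (load G w t u / p)) ^ 2
          ≤ 4 * Y / (ε ^ 2 * p ^ 2) * load G w t u := by
        intro u _
        have h0 := load_nonneg (G := G) hw t u
        calc (2 / ε * (load G w t u / p)) ^ 2
            = 4 / (ε ^ 2 * p ^ 2) * (load G w t u * load G w t u) := by field_simp; ring
          _ ≤ 4 / (ε ^ 2 * p ^ 2) * (Y * load G w t u) :=
            mul_le_mul_of_nonneg_left (mul_le_mul_of_nonneg_right (hload u) h0) (by positivity)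
          _ = _ := by ring
      refine (Finset.sum_le_sum this).trans ?_
      rw [← Finset.mul_sum, ← hS, show 4 * Y * (S + m) / (ε ^ 2 * p ^ 2)
        = 4 * Y / (ε ^ 2 * p ^ 2) * (S + m) by ring]
      have h : S ≤ S + m := by linarith
      exact mul_le_mul_of_nonneg_left h (by positivity)) (by positivity)
  refine (prodProb_mono hP fun r hr => ?_).trans (key.trans (Real.exp_le_exp.2 ?_))
  · exact (add_le_add_left hE _).trans hr
  · rw [neg_le_neg_iff]
    have e : (τ * (S + m)) ^ 2 / (2 * (4 * Y * (S + m) / (ε ^ 2 * p ^ 2)))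
        = τ ^ 2 * (S + m) * ε ^ 2 * p ^ 2 / (8 * Y) := by
      have : S + m ≠ 0 := by positivity
      field_simp
      ring
    rw [e]
    gcongr
    linarith

end Step

/-! ### Random sampling levels -/

/-- The first index at which a bit is set, or the number of bits if there is none. -/
noncomputable def sampleLevel {n : ℕ} (b : Fin n → Bool) : ℕ :=
  sInf {j | n ≤ j ∨ ∃ i : Fin n, i.1 = j ∧ b i = true}

theorem sampleLevel_lt_iff {n : ℕ} (b : Fin n → Bool) {k : ℕ} (hk : k ≤ n) :
    sampleLevel b < k ↔ ∃ i : Fin n, i.1 < k ∧ b i = true := by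
  constructor
  · intro h
    have hne : {j | n ≤ j ∨ ∃ i : Fin n, i.1 = j ∧ b i = true}.Nonempty := ⟨n, Or.inl le_rfl⟩
    rcases Nat.sInf_mem hne with h' | ⟨i, hi, hb⟩
    · exact absurd (lt_of_lt_of_le h hk) (not_lt.2 h')
    · exact ⟨i, lt_of_eq_of_lt hi h, hb⟩
  · rintro ⟨i, hi, hb⟩
    exact lt_of_le_of_lt (Nat.sInf_le (Or.inr ⟨i, rfl, hb⟩)) hi

theorem sampleLevel_le {n : ℕ} (b : Fin n → Bool) : sampleLevel b ≤ n :=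
  Nat.sInf_le (Or.inl le_rfl)

theorem apply_sampleLevel {n : ℕ} (b : Fin n → Bool) (h : sampleLevel b < n) :
    b ⟨sampleLevel b, h⟩ = true := by
  have hne : {j | n ≤ j ∨ ∃ i : Fin n, i.1 = j ∧ b i = true}.Nonempty := ⟨n, Or.inl le_rfl⟩
  rcases Nat.sInf_mem hne with h' | ⟨i, hi, hb⟩
  · exact absurd h (not_lt.2 h')
  · rw [← hb]
    congr 1
    exact Fin.ext hi.symm

/-- The factor with which a node with sampling level `g` counts in step `j`. -/
noncomputable def sampleFactor (p : ℕ → ℝ) (g j : ℕ) : ℝ :=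
  if g < j then 1 else if g < j + 1 then 1 / p j else 0

theorem sampleFactor_eq_one {p : ℕ → ℝ} {n : ℕ} (hp : ∀ j, n ≤ j → p j = 1) (b : Fin n → Bool)
    {j : ℕ} (hj : n ≤ j) : sampleFactor p (sampleLevel b) j = 1 := by
  have := sampleLevel_le b
  rw [sampleFactor, hp j hj, if_pos (by omega : sampleLevel b < j + 1)]
  simp

theorem sampleLevel_update_lt_iff {n : ℕ} (b : Fin n → Bool) (j : Fin n) (x : Bool) {k : ℕ}
    (hk : k ≤ j) : sampleLevel (Function.update b j x) < k ↔ sampleLevel b < k := by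
  rw [sampleLevel_lt_iff _ (hk.trans j.2.le), sampleLevel_lt_iff _ (hk.trans j.2.le)]
  refine exists_congr fun i => and_congr_right fun hi => ?_
  rw [Function.update_of_ne (Fin.ne_of_lt (Fin.lt_def.2 (by omega)))]

theorem sampleFactor_update_of_lt {n : ℕ} (p : ℕ → ℝ) (b : Fin n → Bool) (j : Fin n) (x : Bool)
    {i : ℕ} (hi : i < j) :
    sampleFactor p (sampleLevel (Function.update b j x)) i = sampleFactor p (sampleLevel b) i := by
  simp only [sampleFactor, sampleLevel_update_lt_iff b j x (by omega : i ≤ j),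
    sampleLevel_update_lt_iff b j x (by omega : i + 1 ≤ j)]

theorem sampleFactor_update_self {n : ℕ} (p : ℕ → ℝ) (b : Fin n → Bool) (j : Fin n) (x : Bool) :
    sampleFactor p (sampleLevel (Function.update b j x)) j
      = if sampleLevel b < j then 1 else if x then 1 / p j else 0 := by
  simp only [sampleFactor, sampleLevel_update_lt_iff b j x le_rfl]
  split_ifs with h1 h2 h3 h3
  · rfl
  · rfl
  · exfalso
    obtain ⟨i, hi, hb⟩ := (sampleLevel_lt_iff _ (by omega : j.1 + 1 ≤ n)).1 h2
    by_cases hij : i = j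
    · subst hij
      rw [Function.update_self] at hb
      exact h3 hb
    · rw [Function.update_of_ne hij] at hb
      have : i.1 ≠ j.1 := fun h => hij (Fin.ext h)
      exact h1 ((sampleLevel_lt_iff _ j.2.le).2 ⟨i, by omega, hb⟩)
  · exact absurd ((sampleLevel_lt_iff _ (by omega : j.1 + 1 ≤ n)).2
      ⟨j, Nat.lt_succ_self _, by rw [Function.update_self]; exact h3⟩) h2
  · rfl

section Random

variable {V : Type} [Fintype V] [DecidableEq V] {G : SimpleGraph V} [DecidableRel G.Adj]
  {w : ℕ → ℝ} {a : ℝ}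

theorem level_congr {θ θ' : ℕ → V → ℝ} {j : ℕ} (h : ∀ i < j, ∀ u, θ i u = θ' i u) (v : V) :
    level G w a θ j v = level G w a θ' j v := by
  induction j generalizing v with
  | zero => rfl
  | succ j ih =>
    simp only [level, ih fun i hi => h i (hi.trans (Nat.lt_succ_self j)), h j (Nat.lt_succ_self j)]

/-- The factors for given bits of the nodes. -/
noncomputable def factors (p : ℕ → ℝ) {n : ℕ} (ω : Fin n → V → Bool) (j : ℕ) (v : V) : ℝ :=
  sampleFactor p (sampleLevel fun i => ω i v) j

theorem update_apply_eq {n : ℕ} (ω : Fin n → V → Bool) (j : Fin n) (r : V → Bool) (v : V) :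
    (fun i => Function.update ω j r i v) = Function.update (fun i => ω i v) j (r v) := by
  funext i
  by_cases h : i = j
  · subst h; simp
  · simp [h]

theorem level_update (p : ℕ → ℝ) {n : ℕ} (ω : Fin n → V → Bool) (j : Fin n) (r : V → Bool) (v : V) :
    level G w a (factors p (Function.update ω j r)) j v = level G w a (factors p ω) j v := by
  refine level_congr (fun i hi u => ?_) v
  rw [factors, update_apply_eq, sampleFactor_update_of_lt p _ j _ hi, factors]

/-- The factor in step `j` as a function of the bit of step `j`. -/
noncomputable def bitFactor (p : ℕ → ℝ) {n : ℕ} (ω : Fin n → V → Bool) (j : Fin n) (v : V)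
    (x : Bool) : ℝ :=
  if sampleLevel (fun i => ω i v) < j then 1 else if x then 1 / p j else 0

theorem factors_update (p : ℕ → ℝ) {n : ℕ} (ω : Fin n → V → Bool) (j : Fin n) (r : V → Bool) :
    factors p (Function.update ω j r) j = fun v => bitFactor p ω j v (r v) := by
  funext v
  rw [factors, update_apply_eq, sampleFactor_update_self, bitFactor]

theorem abs_bitFactor_sub_le {p : ℕ → ℝ} (hp0 : ∀ j, 0 < p j) {n : ℕ} (ω : Fin n → V → Bool)
    (j : Fin n) (v : V) (b b' : Bool) :
    |bitFactor p ω j v b - bitFactor p ω j v b'| ≤ 1 / p j := by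
  have := hp0 j
  have h : 0 ≤ 1 / p j := by positivity
  rw [bitFactor, bitFactor, abs_le]
  split_ifs <;> constructor <;> linarith

theorem bitFactor_mean {p : ℕ → ℝ} (hp0 : ∀ j, 0 < p j) {n : ℕ} (ω : Fin n → V → Bool)
    (j : Fin n) (v : V) :
    p j * bitFactor p ω j v true + (1 - p j) * bitFactor p ω j v false = 1 := by
  have := (hp0 j).ne'
  rw [bitFactor, bitFactor]
  by_cases h : sampleLevel (fun i => ω i v) < j
  · simp [h]
  · simp [h, this]

theorem deviation_one (t : V → ℕ) {η : V → ℝ} (hη : ∀ u, η u = 1) (v : V) :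
    deviation G w t η v = 0 := by
  simp [deviation, hη]

theorem excess_zero (ε : ℝ) : excess ε 0 = 0 := by simp [excess]

/-- With high probability the estimates of the loads have a small total penalty. -/
theorem prodProb_excess_sum_le {p : ℕ → ℝ} {ε m Y q : ℝ} {n D L : ℕ} (hε : 0 < ε)
    (hε' : ε ≤ 1 / 1000) (hw : ∀ i, 0 < w i) (hmono : Monotone w)
    (hstep : ∀ i, w (i + 1) ≤ (1 + ε) * w i) (hw1 : w 0 * D ≤ 1) (hD : G.maxDegree ≤ D)
    (hp0 : ∀ j, 0 < p j) (hp1 : ∀ j, p j ≤ 1) (hp : ∀ j, n ≤ j → p j = 1) (hn : 0 < n)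
    (hnL : n ≤ L) (hm : 0 < m) (hY : 4 ≤ Y) (hq : 0 < q) (hqp : ∀ j < n, q ≤ p j)
    (hwp : ∀ j < n, w j ≤ p j ^ 2)
    (hsum : ∑ j ∈ Finset.range n, 4 * w j / (p j ^ 2 * ε ^ 2) ≤ ε) :
    prodProb (fun (j : Fin n) (r : V → Bool) => ∏ v, bernoulliLaw (p j) (r v))
      {ω | ¬ ∑ j ∈ Finset.range L, ∑ v, excess ε
          (deviation G w (level G w (1 - 2 * ε) (factors p ω) j) (factors p ω j) v)
        ≤ 2 * ε * ∑ v, load G w (level G w (1 - 2 * ε) (factors p ω) L) v + ε * m}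
      ≤ n * (Fintype.card V * Real.exp (-(Y / 16))
        + Real.exp (-((ε / n) ^ 2 * m * ε ^ 2 * q ^ 2 / (8 * Y)))) := by
  set lv : (Fin n → V → Bool) → ℕ → V → ℕ := fun ω => level G w (1 - 2 * ε) (factors p ω) with hlv
  set dv : (Fin n → V → Bool) → ℕ → V → ℝ := fun ω j v =>
    deviation G w (lv ω j) (factors p ω j) v with hdv
  have hlaw : ∀ j, IsLaw (fun _ : V => bernoulliLaw (p j)) := fun j =>
    isLaw_bernoulliLaw (fun _ => (hp0 j).le) fun _ => hp1 j
  have hP : IsLaw (fun (j : Fin n) (r : V → Bool) => ∏ v, bernoulliLaw (p j) (r v)) := by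
    refine ⟨fun j r => Finset.prod_nonneg fun v _ => (hlaw j).nonneg v _, fun j => ?_⟩
    rw [← Fintype.prod_sum]
    exact Finset.prod_eq_one fun v _ => (hlaw j).sum_eq_one v
  set bad1 : Fin n → V → Set (Fin n → V → Bool) := fun j v =>
    {ω | Y / 2 ≤ load G w (lv ω j) v ∧ dv ω j v ≤ -(load G w (lv ω j) v / 2)} with hbad1
  set bad2 : Fin n → Set (Fin n → V → Bool) := fun j =>
    {ω | (∀ v, load G w (lv ω j) v ≤ Y) ∧
      4 * w j / (p j ^ 2 * ε ^ 2) * ∑ v, load G w (lv ω j) v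
        + ε / n * (∑ v, load G w (lv ω j) v + m) ≤ ∑ v, excess ε (dv ω j v)} with hbad2
  have hupd_lv : ∀ ω (j : Fin n) r, lv (Function.update ω j r) j = lv ω j := fun ω j r => by
    funext v
    exact level_update p ω j r v
  have hupd_dv : ∀ ω (j : Fin n) r v, dv (Function.update ω j r) j v
      = deviation G w (lv ω j) (fun u => bitFactor p ω j u (r u)) v := fun ω j r v => by
    rw [hdv]
    simp only [hupd_lv, factors_update]
  have hWj : ∀ ω (j : Fin n) u, w (lv ω j u) ≤ w j := fun ω j u => hmono (level_le _ _)
  have hcoord : ∀ (A : Set (Fin n → V → Bool)) (j : Fin n) (δ : ℝ),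
      (∀ ω, prodProb (fun _ : V => bernoulliLaw (p j)) {r | Function.update ω j r ∈ A} ≤ δ) →
      prodProb (fun (j : Fin n) (r : V → Bool) => ∏ v, bernoulliLaw (p j) (r v)) A ≤ δ :=
    fun A j δ h => prodProb_le_of_coord hP j h
  have hempty : ∀ j, prodProb (fun _ : V => bernoulliLaw (p j)) ∅ = 0 := fun j => by
    rw [prodProb, Set.indicator_empty]
    exact prodExp_const (hlaw j) 0
  have hprob1 : ∀ j v, prodProb (fun (j : Fin n) (r : V → Bool) => ∏ v, bernoulliLaw (p j) (r v))
      (bad1 j v) ≤ Real.exp (-(Y / 16)) := by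
    intro j v
    refine hcoord _ j _ fun ω => ?_
    by_cases hY2 : Y / 2 ≤ load G w (lv ω j) v
    · have hpos : 0 < load G w (lv ω j) v := by linarith
      have h := prodProb_deviation_le (G := G) (t := lv ω j) (η := bitFactor p ω j) hw (hWj ω j)
        hmono (hp0 j) (hp1 j) (hwp j j.2) (fun u b b' => abs_bitFactor_sub_le hp0 ω j u b b')
        (fun u => bitFactor_mean hp0 ω j u) v hpos
      refine le_trans (prodProb_mono (hlaw j) fun r hr => ?_) (h.trans (Real.exp_le_exp.2 ?_))
      · have := hr.2
        rw [hupd_dv, hupd_lv] at this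
        exact this
      · linarith
    · rw [show {r | Function.update ω j r ∈ bad1 j v} = ∅ from
        Set.eq_empty_of_forall_notMem fun r hr => hY2 (by
          have := hr.1
          rwa [hupd_lv] at this), hempty]
      exact (Real.exp_pos _).le
  have hprob2 : ∀ j, prodProb (fun (j : Fin n) (r : V → Bool) => ∏ v, bernoulliLaw (p j) (r v))
      (bad2 j) ≤ Real.exp (-((ε / n) ^ 2 * m * ε ^ 2 * q ^ 2 / (8 * Y))) := by
    intro j
    refine hcoord _ j _ fun ω => ?_
    by_cases hload : ∀ v, load G w (lv ω j) v ≤ Y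
    · have h := prodProb_excess_le (G := G) (t := lv ω j) (η := bitFactor p ω j) hw (hWj ω j)
        hmono (hp0 j) (hp1 j) (fun u b b' => abs_bitFactor_sub_le hp0 ω j u b b')
        (fun u => bitFactor_mean hp0 ω j u) hε (τ := ε / n) (by positivity) hm
        (by linarith : 0 < Y) hload
      refine le_trans (prodProb_mono (hlaw j) fun r hr => ?_) (h.trans (Real.exp_le_exp.2 ?_))
      · have := hr.2
        simp only [hupd_dv, hupd_lv] at this
        exact this
      · rw [neg_le_neg_iff]
        have := hqp j j.2
        gcongr
    · rw [show {r | Function.update ω j r ∈ bad2 j} = ∅ from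
        Set.eq_empty_of_forall_notMem fun r hr => hload (by
          have := hr.1
          rwa [hupd_lv] at this), hempty]
      exact (Real.exp_pos _).le
  have hsub : {ω | ¬ ∑ j ∈ Finset.range L, ∑ v, excess ε (dv ω j v)
        ≤ 2 * ε * ∑ v, load G w (lv ω L) v + ε * m} ⊆ ⋃ j, ((⋃ v, bad1 j v) ∪ bad2 j) := by
    intro ω hω
    by_contra hgood
    refine hω ?_
    simp only [Set.mem_iUnion, Set.mem_union, not_exists, not_or] at hgood
    have hone : ∀ j, n ≤ j → ∀ v, dv ω j v = 0 := fun j hj v =>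
      deviation_one _ (fun u => sampleFactor_eq_one hp _ hj) v
    have hload : ∀ j v, load G w (lv ω j) v ≤ Y := by
      intro j v
      rcases level_eq_zero_or (G := G) (θ := factors p ω) (a := 1 - 2 * ε) hε hw hstep j v with
        h0 | ⟨i, -, -, hest, hl⟩
      · exact (load_level_zero_le hw1 hw hD h0).trans (by linarith)
      · by_contra hY'
        push Not at hY'
        change load G w (lv ω i) v + dv ω i v < 1 - 2 * ε at hest
        change load G w (lv ω j) v ≤ (1 + ε) * load G w (lv ω i) v at hl
        have h2 : Y / 2 ≤ load G w (lv ω i) v := by nlinarith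
        rcases Nat.lt_or_ge i n with hi | hi
        · exact (hgood ⟨i, hi⟩).1 v ⟨h2, by
            change dv ω i v ≤ -(load G w (lv ω i) v / 2)
            linarith⟩
        · rw [hone i hi] at hest
          linarith
    set S := ∑ v, load G w (lv ω L) v
    have hS0 : 0 ≤ S := Finset.sum_nonneg fun v _ => load_nonneg hw _ v
    have hterm : ∀ j ∈ Finset.range n, ∑ v, excess ε (dv ω j v)
        ≤ 4 * w j / (p j ^ 2 * ε ^ 2) * S + ε / n * (S + m) := by
      intro j hj
      have hj' := Finset.mem_range.1 hj
      have h2 := (hgood ⟨j, hj'⟩).2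
      have h3 : ¬ (4 * w j / (p j ^ 2 * ε ^ 2) * ∑ v, load G w (lv ω j) v
          + ε / n * (∑ v, load G w (lv ω j) v + m) ≤ ∑ v, excess ε (dv ω j v)) :=
        fun h => h2 ⟨hload j, h⟩
      refine (not_le.1 h3).le.trans ?_
      have hSj : ∑ v, load G w (lv ω j) v ≤ S := Finset.sum_le_sum fun v _ =>
        load_mono hmono (fun u => level_mono (hj'.le.trans hnL) u) v
      have := hw j
      have := hp0 j
      gcongr
    calc ∑ j ∈ Finset.range L, ∑ v, excess ε (dv ω j v)
        = ∑ j ∈ Finset.range n, ∑ v, excess ε (dv ω j v) := by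
          symm
          refine Finset.sum_subset (Finset.range_mono hnL) fun j _ hj => ?_
          refine Finset.sum_eq_zero fun v _ => ?_
          rw [hone j (not_lt.1 fun h => hj (Finset.mem_range.2 h)), excess_zero]
      _ ≤ ∑ j ∈ Finset.range n, (4 * w j / (p j ^ 2 * ε ^ 2) * S + ε / n * (S + m)) :=
          Finset.sum_le_sum hterm
      _ = (∑ j ∈ Finset.range n, 4 * w j / (p j ^ 2 * ε ^ 2)) * S + ε * (S + m) := by
          rw [Finset.sum_add_distrib, Finset.sum_mul, Finset.sum_const, Finset.card_range,
            nsmul_eq_mul]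
          have : (n : ℝ) ≠ 0 := by positivity
          rw [← mul_assoc, mul_div_cancel₀ _ this]
      _ ≤ ε * S + ε * (S + m) := by gcongr
      _ = 2 * ε * S + ε * m := by ring
  refine (prodProb_mono hP hsub).trans ((prodProb_iUnion_le hP _).trans ?_)
  refine (Finset.sum_le_card_nsmul _ _ _ fun j _ =>
    (prodProb_union_le hP _ _).trans (add_le_add ?_ (hprob2 j))).trans
    (by rw [Finset.card_univ, Fintype.card_fin, nsmul_eq_mul])
  refine (prodProb_iUnion_le hP _).trans ?_
  rw [← nsmul_eq_mul, ← Finset.card_univ]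
  exact Finset.sum_le_card_nsmul _ _ _ fun v _ => hprob1 j v

end Random

/-! ### The node program -/

/-- The local state of a node: its sampling level, the number of the round, the number of rounds to
sleep, its level, the sampling levels and levels of its neighbours as far as they are known, whether
it is overloaded, and which of its neighbours are. -/
structure NodeState where
  sample : ℕ
  clock : ℕ
  delay : ℕ
  lvl : ℕ
  info : ℕ → Option (ℕ × ℕ)
  full : Bool
  nbrOver : ℕ → Bool

/-- The level of a node, computed from the sampling levels and levels of its neighbours. -/
noncomputable def localLevel (w : ℕ → ℝ) (a : ℝ) (p : ℕ → ℝ) (d : ℕ) (info : ℕ → Option (ℕ × ℕ)) :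
    ℕ → ℕ
  | 0 => 0
  | i + 1 =>
    if localLevel w a p d info i = i ∧ ∑ q : Fin d,
      (info q).elim 0 (fun x => sampleFactor p x.1 i * w (min i x.2)) < a then i + 1
    else localLevel w a p d info i

/-- The message about the sampling level and the level. If all nodes are awake from the beginning,
it suffices to send a bit that says whether the node is still active. -/
def encodeLevel (n clock sample lvl : ℕ) : List Bool :=
  if n = 0 then [decide (lvl = clock)] else Nat.bits (Nat.pair sample lvl)

/-- The information about a neighbour after a message, from the information before. -/
noncomputable def decodeLevel (n clock : ℕ) (old : Option (ℕ × ℕ)) (m : Option (List Bool)) :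
    Option (ℕ × ℕ) :=
  m.map fun b => if n = 0 then (0, if b = [true] then clock else (old.getD (0, 0)).2)
    else Nat.unpair (Function.invFun Nat.bits b)

/-- The information about the neighbours after a round. -/
noncomputable def newInfo (n d : ℕ) (s : NodeState) (box : Fin d → Option (List Bool)) (q : ℕ) :
    Option (ℕ × ℕ) :=
  if h : q < d then decodeLevel n s.clock (s.info q) (box ⟨q, h⟩) else none

/-- The law of `n` independent bits. -/
noncomputable def bitsPMF (p : ℕ → ℝ) (hp0 : ∀ j, 0 < p j) (hp1 : ∀ j, p j ≤ 1) (n : ℕ) :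
    PMF (Fin n → Bool) :=
  PMF.ofFintype (fun b => ENNReal.ofReal (∏ j : Fin n, bernoulliLaw (p j) (b j))) (by
    have hP := isLaw_bernoulliLaw (ι := Fin n) (p := fun j => p j) (fun j => (hp0 j).le)
      (fun j => hp1 j)
    rw [← ENNReal.ofReal_sum_of_nonneg fun b _ => Finset.prod_nonneg fun j _ => hP.nonneg j _,
      ← Fintype.prod_sum, Finset.prod_eq_one fun j _ => hP.sum_eq_one j, ENNReal.ofReal_one])

/-- Nodes wake up in the round before their sampling level, and stay awake until the end. In rounds
`0, …, L` they compute their levels; in round `L + 1` the overloaded nodes tell their neighbours. -/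
noncomputable def levelProgram (w : ℕ → ℝ) (a : ℝ) (p : ℕ → ℝ) (hp0 : ∀ j, 0 < p j)
    (hp1 : ∀ j, p j ≤ 1) (n L : ℕ) : NodeProgram where
  Seed := Fin n → Bool
  State := NodeState
  law := bitsPMF p hp0 hp1 n
  init := fun _ b => ⟨sampleLevel b, sampleLevel b - 1, sampleLevel b - 1, 0, fun _ => none, false,
    fun _ => false⟩
  send := fun _ s _ =>
    if s.clock ≤ L then
      if s.sample ≤ s.clock then some (encodeLevel n s.clock s.sample s.lvl) else none
    else some [s.full]
  step := fun d s box =>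
    if s.clock ≤ L then
      { s with
        clock := s.clock + 1
        delay := 0
        info := newInfo n d s box
        lvl := if s.clock < L then localLevel w a p d (newInfo n d s box) (s.clock + 1) else s.lvl
        full := decide (1 < ∑ q : Fin d, w (min ((newInfo n d s box q).getD (0, 0)).2 s.lvl)) }
    else
      { s with
        clock := s.clock + 1
        delay := 0
        nbrOver := fun q => if h : q < d then decide (box ⟨q, h⟩ = some [true]) else false }
  wait := fun s => if s.clock ≤ L + 1 then some s.delay else none
  output := fun _ s q =>
    if s.full = true ∨ s.nbrOver q = true then 0 else w (min s.lvl ((s.info q).getD (0, 0)).2)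

theorem bits_injective : Function.Injective Nat.bits := fun x y h => by
  refine Nat.digits.injective 2 ?_
  rw [Nat.digits_two_eq_bits, Nat.digits_two_eq_bits, h]

section Run

variable {V : Type} [Fintype V] [DecidableEq V] {G : SimpleGraph V} [DecidableRel G.Adj]
  {w : ℕ → ℝ} {a : ℝ} {p : ℕ → ℝ} {hp0 : ∀ j, 0 < p j} {hp1 : ∀ j, p j ≤ 1} {n L : ℕ}

theorem sum_port (port : PortNumbering G) (v : V) (f : V → ℝ) :
    ∑ q : Fin (G.degree v), f (port v q) = ∑ u ∈ G.neighborFinset v, f u := by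
  rw [Equiv.sum_comp (port v) (fun u : G.neighborSet v => f u)]
  exact (Finset.sum_subtype (G.neighborFinset v) (fun u => by simp) f).symm

/-- The levels that the program computes. -/
noncomputable def seedLevel (G : SimpleGraph V) [DecidableRel G.Adj] (w : ℕ → ℝ) (a : ℝ) (p : ℕ → ℝ)
    (ω : V → Fin n → Bool) : ℕ → V → ℕ :=
  level G w a fun j v => sampleFactor p (sampleLevel (ω v)) j

theorem localLevel_eq (port : PortNumbering G) (ω : V → Fin n → Bool) (v : V) {t : ℕ}
    {info : ℕ → Option (ℕ × ℕ)}
    (hinfo : ∀ q : Fin (G.degree v), info q = if sampleLevel (ω (port v q)) ≤ t then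
      some (sampleLevel (ω (port v q)), seedLevel G w a p ω t (port v q)) else none)
    {i : ℕ} (hi : i ≤ t + 1) :
    localLevel w a p (G.degree v) info i = seedLevel G w a p ω i v := by
  induction i with
  | zero => rfl
  | succ i ih =>
    have hit : i ≤ t := by omega
    have hs : ∑ q : Fin (G.degree v),
        (info q).elim 0 (fun x => sampleFactor p x.1 i * w (min i x.2))
        = ∑ u ∈ G.neighborFinset v, sampleFactor p (sampleLevel (ω u)) i
          * w (seedLevel G w a p ω i u) := by
      rw [← sum_port port v]
      refine Finset.sum_congr rfl fun q _ => ?_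
      rw [hinfo q]
      split_ifs with h
      · have : seedLevel G w a p ω i (port v q) = min i (seedLevel G w a p ω t (port v q)) :=
          level_eq_min hit _
        rw [this]
        rfl
      · rw [sampleFactor, if_neg (by omega), if_neg (by omega)]
        simp
    rw [localLevel, ih (by omega), hs]
    rfl

theorem decodeLevel_encodeLevel (ω : V → Fin n → Bool) (u : V) {t : ℕ} {old : Option (ℕ × ℕ)}
    (hold : n = 0 → 0 < t → old = some (0, seedLevel G w a p ω (t - 1) u)) :
    decodeLevel n t old (some (encodeLevel n t (sampleLevel (ω u)) (seedLevel G w a p ω t u)))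
      = some (sampleLevel (ω u), seedLevel G w a p ω t u) := by
  by_cases hn : n = 0
  · have hg : sampleLevel (ω u) = 0 := by
      have := sampleLevel_le (ω u)
      omega
    rw [decodeLevel, encodeLevel, if_pos hn, hg, Option.map_some, if_pos hn]
    by_cases h : seedLevel G w a p ω t u = t
    · simp [h]
    · have ht : 0 < t := by
        rcases Nat.eq_zero_or_pos t with h0 | h0
        · subst h0
          exact absurd rfl h
        · exact h0
      obtain ⟨j, rfl⟩ : ∃ j, t = j + 1 := ⟨t - 1, by omega⟩
      have : seedLevel G w a p ω (j + 1) u = seedLevel G w a p ω j u := by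
        rcases level_succ_cases (G := G) (w := w) (a := a)
          (θ := fun j v => sampleFactor p (sampleLevel (ω v)) j) j u with h' | h'
        · exact absurd h'.1 h
        · exact h'.1
      rw [hold hn ht]
      rw [this] at h ⊢
      simp [h]
  · rw [decodeLevel, encodeLevel, if_neg hn, Option.map_some, if_neg hn,
      Function.leftInverse_invFun bits_injective, Nat.unpair_pair]

/-- What is true of the statuses at the beginning of round `t ≤ L`. -/
structure RunInvariant (G : SimpleGraph V) [DecidableRel G.Adj] (w : ℕ → ℝ) (a : ℝ) (p : ℕ → ℝ)
    (port : PortNumbering G) (ω : V → Fin n → Bool) (t : ℕ) (v : V) (c : NodeState × Option ℕ) :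
    Prop where
  asleep : t < sampleLevel (ω v) - 1 → c.2 = some (sampleLevel (ω v) - 1 - t) ∧
    c.1.clock = sampleLevel (ω v) - 1
  awake : sampleLevel (ω v) - 1 ≤ t → c.2 = some 0 ∧ c.1.clock = t
  sample : c.1.sample = sampleLevel (ω v)
  lvl : sampleLevel (ω v) ≤ t → c.1.lvl = seedLevel G w a p ω t v
  info : n = 0 → 0 < t → ∀ q : Fin (G.degree v),
    c.1.info q = some (0, seedLevel G w a p ω (t - 1) (port v q))
  nbrOver : c.1.nbrOver = fun _ => false

theorem newInfo_eq (port : PortNumbering G) (ω : V → Fin n → Bool) {t : ℕ} (ht : t ≤ L)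
    {c : V → NodeState × Option ℕ} (hc : ∀ v, RunInvariant G w a p port ω t v (c v)) (v : V)
    (hv : sampleLevel (ω v) - 1 ≤ t) (q : Fin (G.degree v)) :
    newInfo n (G.degree v) (c v).1 ((levelProgram w a p hp0 hp1 n L).inbox port c v) q
      = if sampleLevel (ω (port v q)) ≤ t then
        some (sampleLevel (ω (port v q)), seedLevel G w a p ω t (port v q)) else none := by
  have hu := hc (port v q)
  rw [newInfo, dif_pos q.2, ((hc v).awake hv).2]
  have hbox : (levelProgram w a p hp0 hp1 n L).inbox port c v q
      = if sampleLevel (ω (port v q)) ≤ t then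
        some (encodeLevel n t (sampleLevel (ω (port v q))) (seedLevel G w a p ω t (port v q)))
        else none := by
    by_cases hg : sampleLevel (ω (port v q)) ≤ t
    · have h1 := hu.awake (by omega)
      rw [if_pos hg]
      simp [NodeProgram.inbox, h1.1, levelProgram, h1.2, ht, hu.sample, hg, hu.lvl hg]
    · rw [if_neg hg]
      rcases Nat.lt_or_ge t (sampleLevel (ω (port v q)) - 1) with h | h
      · have h1 := (hu.asleep h).1
        have h2 : sampleLevel (ω (port v q)) - 1 - t ≠ 0 := by omega
        simp [NodeProgram.inbox, h1, h2]
      · have h1 := hu.awake h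
        simp [NodeProgram.inbox, h1.1, levelProgram, h1.2, ht, hu.sample, hg]
  change decodeLevel n t _ ((levelProgram w a p hp0 hp1 n L).inbox port c v q) = _
  rw [hbox]
  split_ifs with hg
  · exact decodeLevel_encodeLevel ω _ fun hn h0 => (hc v).info hn h0 q
  · rfl

theorem runInvariant (port : PortNumbering G) (ω : V → Fin n → Bool) (hnL : n ≤ L) {t : ℕ}
    (ht : t ≤ L) (v : V) :
    RunInvariant G w a p port ω t v ((levelProgram w a p hp0 hp1 n L).run port ω t v) := by
  have hg : ∀ v, sampleLevel (ω v) ≤ L := fun v => (sampleLevel_le _).trans hnL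
  induction t generalizing v with
  | zero =>
    have := hg v
    have h2 : sampleLevel (ω v) ≤ L + 1 + 1 := by omega
    refine ⟨fun h => ?_, fun h => ?_, rfl, fun h => rfl, fun _ h => absurd h (lt_irrefl 0), rfl⟩
    · simp [NodeProgram.run, levelProgram, h2]
    · have h3 : sampleLevel (ω v) - 1 = 0 := by omega
      simp [NodeProgram.run, levelProgram, h3]
  | succ t ih =>
    have iht := ih (by omega)
    set c := (levelProgram w a p hp0 hp1 n L).run port ω t with hc
    have hv := iht v
    rcases Nat.lt_or_ge t (sampleLevel (ω v) - 1) with h | h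
    · obtain ⟨h1, h2⟩ := hv.asleep h
      obtain ⟨k, hk⟩ : ∃ k, sampleLevel (ω v) - 1 - t = k + 1 := ⟨_, (by omega :
        sampleLevel (ω v) - 1 - t = (sampleLevel (ω v) - 1 - t - 1) + 1)⟩
      have hrun : (levelProgram w a p hp0 hp1 n L).run port ω (t + 1) v = ((c v).1, some k) := by
        simp [NodeProgram.run, ← hc, NodeProgram.round, h1, hk]
      rw [hrun]
      refine ⟨fun h' => ⟨?_, h2⟩, fun h' => ⟨?_, ?_⟩, hv.sample, fun h' => ?_, fun hn _ => ?_,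
        hv.nbrOver⟩
      · simp only [Option.some.injEq]
        omega
      · simp only [Option.some.injEq]
        omega
      · simp only [h2]
        omega
      · omega
      · have := sampleLevel_le (ω v)
        omega
    · obtain ⟨h1, h2⟩ := hv.awake h
      have hinfo := newInfo_eq (hp0 := hp0) (hp1 := hp1) port ω (by omega : t ≤ L) iht v h
      have hloc := localLevel_eq (i := t + 1) port ω v hinfo le_rfl
      have hrun : (levelProgram w a p hp0 hp1 n L).run port ω (t + 1) v
          = ((levelProgram w a p hp0 hp1 n L).step (G.degree v) (c v).1
              ((levelProgram w a p hp0 hp1 n L).inbox port c v),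
            (levelProgram w a p hp0 hp1 n L).wait
              ((levelProgram w a p hp0 hp1 n L).step (G.degree v) (c v).1
                ((levelProgram w a p hp0 hp1 n L).inbox port c v))) := by
        simp [NodeProgram.run, ← hc, NodeProgram.round, h1]
      rw [hrun]
      have htL : t ≤ L := by omega
      have htL' : t < L := by omega
      refine ⟨fun h' => by omega, fun _ => ⟨?_, ?_⟩, ?_, fun h' => ?_, fun hn _ q => ?_, ?_⟩
      · simp [levelProgram, h2, htL]
      · simp [levelProgram, h2, htL]
      · simp only [levelProgram, h2, htL, if_true]
        exact hv.sample
      · simp only [levelProgram, h2, htL, htL', if_true]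
        exact hloc
      · have hu : sampleLevel (ω (port v q)) = 0 := by
          have := sampleLevel_le (ω (port v q))
          omega
        simp only [levelProgram, h2, htL, if_true, Nat.add_sub_cancel]
        refine (hinfo q).trans ?_
        rw [if_pos (by omega), hu]
      · simp only [levelProgram, h2, htL, if_true]
        exact hv.nbrOver

end Run

section Results

variable {V : Type} [Fintype V] [DecidableEq V] {G : SimpleGraph V} [DecidableRel G.Adj]
  {w : ℕ → ℝ} {a : ℝ} {p : ℕ → ℝ} {hp0 : ∀ j, 0 < p j} {hp1 : ∀ j, p j ≤ 1} {n L : ℕ}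

theorem levelProgram_run_succ (port : PortNumbering G) (ω : V → Fin n → Bool) (t : ℕ) (v : V)
    (h : ((levelProgram w a p hp0 hp1 n L).run port ω t v).2 = some 0) :
    (levelProgram w a p hp0 hp1 n L).run port ω (t + 1) v
      = ((levelProgram w a p hp0 hp1 n L).step (G.degree v)
          ((levelProgram w a p hp0 hp1 n L).run port ω t v).1
          ((levelProgram w a p hp0 hp1 n L).inbox port
            ((levelProgram w a p hp0 hp1 n L).run port ω t) v),
        (levelProgram w a p hp0 hp1 n L).wait ((levelProgram w a p hp0 hp1 n L).step (G.degree v)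
          ((levelProgram w a p hp0 hp1 n L).run port ω t v).1
          ((levelProgram w a p hp0 hp1 n L).inbox port
            ((levelProgram w a p hp0 hp1 n L).run port ω t) v))) := by
  simp [NodeProgram.run, NodeProgram.round, h]

theorem run_add_of_terminated (P : NodeProgram) (port : PortNumbering G) (ω : V → P.Seed) (t : ℕ)
    (v : V) (h : (P.run port ω t v).2 = none) (s : ℕ) :
    P.run port ω (t + s) v = P.run port ω t v := by
  induction s with
  | zero => rfl
  | succ s ih =>
    rw [← ih] at h
    rw [← ih, ← add_assoc]
    simp [NodeProgram.run, NodeProgram.round, h]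

/-- The statuses after the computation of the levels. -/
theorem run_final (port : PortNumbering G) (ω : V → Fin n → Bool) (hnL : n ≤ L) (v : V) :
    ((levelProgram w a p hp0 hp1 n L).run port ω (L + 1) v).2 = some 0 ∧
    ((levelProgram w a p hp0 hp1 n L).run port ω (L + 1) v).1.clock = L + 1 ∧
    ((levelProgram w a p hp0 hp1 n L).run port ω (L + 1) v).1.lvl = seedLevel G w a p ω L v ∧
    (∀ q : Fin (G.degree v), ((levelProgram w a p hp0 hp1 n L).run port ω (L + 1) v).1.info q
      = some (sampleLevel (ω (port v q)), seedLevel G w a p ω L (port v q))) ∧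
    ((levelProgram w a p hp0 hp1 n L).run port ω (L + 1) v).1.full
      = decide (1 < load G w (seedLevel G w a p ω L) v) := by
  have hg : ∀ v, sampleLevel (ω v) ≤ L := fun v => (sampleLevel_le _).trans hnL
  have hinv := runInvariant (G := G) (w := w) (a := a) (hp0 := hp0) (hp1 := hp1) port ω hnL
    (le_refl L)
  have hgv := hg v
  obtain ⟨h1, h2⟩ := (hinv v).awake (by omega)
  have hlvl := (hinv v).lvl (hg v)
  have hinfo : ∀ q : Fin (G.degree v), newInfo n (G.degree v)
      ((levelProgram w a p hp0 hp1 n L).run port ω L v).1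
      ((levelProgram w a p hp0 hp1 n L).inbox port
        ((levelProgram w a p hp0 hp1 n L).run port ω L) v) q
      = some (sampleLevel (ω (port v q)), seedLevel G w a p ω L (port v q)) := fun q => by
    rw [newInfo_eq (hp0 := hp0) (hp1 := hp1) port ω le_rfl hinv v (by omega) q, if_pos (hg _)]
  rw [levelProgram_run_succ port ω L v h1]
  set c := (levelProgram w a p hp0 hp1 n L).run port ω L with hc
  refine ⟨?_, ?_, ?_, fun q => ?_, ?_⟩
  · simp [levelProgram, h2]
  · simp [levelProgram, h2]
  · simp only [levelProgram, h2, le_refl, if_true, lt_irrefl, if_false]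
    exact hlvl
  · simp only [levelProgram, h2, le_refl, if_true]
    exact hinfo q
  · have hs : load G w (seedLevel G w a p ω L) v
        = ∑ q : Fin (G.degree v), w (min ((newInfo n (G.degree v)
          (c v).1
          ((levelProgram w a p hp0 hp1 n L).inbox port
            c v) q).getD (0, 0)).2
          (c v).1.lvl) := by
      rw [load, ← sum_port port v]
      refine Finset.sum_congr rfl fun q _ => ?_
      rw [hinfo q, hlvl]
      rfl
    rw [hs]
    simp only [levelProgram, h2, le_refl, if_true]
    rfl

theorem levelProgram_terminatesWithin (port : PortNumbering G) (ω : V → Fin n → Bool)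
    (hnL : n ≤ L) : (levelProgram w a p hp0 hp1 n L).TerminatesWithin port ω (L + 2) := by
  intro v
  obtain ⟨h1, h2, -⟩ := run_final (G := G) (w := w) (a := a) (hp0 := hp0) (hp1 := hp1) port ω hnL v
  rw [levelProgram_run_succ port ω (L + 1) v h1]
  set c := (levelProgram w a p hp0 hp1 n L).run port ω (L + 1) with hc
  have hL : ¬ L + 1 ≤ L := by omega
  simp [levelProgram, h2, hL]

theorem levelProgram_outputs (port : PortNumbering G) (ω : V → Fin n → Bool) (hnL : n ≤ L) :
    (levelProgram w a p hp0 hp1 n L).Outputs port ω (L + 2)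
      (prunedWeights G w (seedLevel G w a p ω L)) := by
  intro v q
  have hf := run_final (G := G) (w := w) (a := a) (hp0 := hp0) (hp1 := hp1) port ω hnL
  obtain ⟨h1, h2, h3, h4, h5⟩ := hf v
  obtain ⟨u1, u2, u3, u4, u5⟩ := hf (port v q)
  rw [levelProgram_run_succ port ω (L + 1) v h1]
  set c := (levelProgram w a p hp0 hp1 n L).run port ω (L + 1) with hc
  have hbox : (levelProgram w a p hp0 hp1 n L).inbox port c v q
      = some [decide (1 < load G w (seedLevel G w a p ω L) (port v q))] := by
    rw [← u5]
    simp [NodeProgram.inbox, u1, levelProgram, u2]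
  have hadj : G.Adj v (port v q) := (port v q).2
  have hL : ¬ L + 1 ≤ L := by omega
  simp only [levelProgram, h2, hL, if_false, prunedWeights, Sym2.lift_mk, hadj, true_and]
  simp only [levelProgram] at hbox
  simp only [Fin.is_lt, dif_pos, Fin.eta, h5, h3, h4 q, hbox]
  by_cases ha : load G w (seedLevel G w a p ω L) v ≤ 1 <;>
    by_cases hb : load G w (seedLevel G w a p ω L) (port v q) ≤ 1 <;>
    simp [ha, hb, not_lt.2, not_le.1]

theorem awake_imp (port : PortNumbering G) (ω : V → Fin n → Bool) (hnL : n ≤ L) {t : ℕ} {v : V}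
    (h : (levelProgram w a p hp0 hp1 n L).Awake port ω t v) :
    sampleLevel (ω v) - 1 ≤ t ∧ t ≤ L + 1 := by
  have hg : sampleLevel (ω v) ≤ L := (sampleLevel_le _).trans hnL
  constructor
  · by_contra hlt
    have := (runInvariant (G := G) (w := w) (a := a) (hp0 := hp0) (hp1 := hp1) port ω hnL
      (by omega : t ≤ L) v).asleep (by omega)
    have h' := this.1.symm.trans h
    rw [Option.some.injEq] at h'
    omega
  · by_contra hlt
    obtain ⟨s, rfl⟩ : ∃ s, t = L + 2 + s := ⟨t - (L + 2), by omega⟩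
    have ht : ((levelProgram w a p hp0 hp1 n L).run port ω (L + 2) v).2 = none :=
      levelProgram_terminatesWithin (w := w) (a := a) (hp0 := hp0) (hp1 := hp1) port ω hnL v
    have e := run_add_of_terminated (levelProgram w a p hp0 hp1 n L) port ω (L + 2) v ht s
    exact Option.some_ne_none _ ((((congrArg Prod.snd e).trans ht).symm.trans h).symm)

theorem levelProgram_awakeComplexity_le (port : PortNumbering G) (ω : V → Fin n → Bool)
    (hnL : n ≤ L) (v : V) :
    (levelProgram w a p hp0 hp1 n L).awakeComplexity port ω v ≤ L + 3 - sampleLevel (ω v) := by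
  have hsub : {t | (levelProgram w a p hp0 hp1 n L).Awake port ω t v}
      ⊆ (Finset.Icc (sampleLevel (ω v) - 1) (L + 1) : Finset ℕ) := fun t ht => by
    simpa using awake_imp port ω hnL ht
  refine (Set.ncard_le_ncard hsub (Finset.finite_toSet _)).trans ?_
  rw [Set.ncard_coe_finset, Nat.card_Icc]
  omega

theorem levelProgram_messagesAtMost (port : PortNumbering G) (ω : V → Fin n → Bool) (hnL : n ≤ L)
    {b : ℝ} (hb1 : ∀ v : V, 0 < G.degree v → 1 ≤ b)
    (hb2 : n ≠ 0 → ∀ g ≤ L, ∀ l ≤ L, ((Nat.bits (Nat.pair g l)).length : ℝ) ≤ b) :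
    (levelProgram w a p hp0 hp1 n L).MessagesAtMost port ω b := by
  intro t v hv q m hm
  have hb := hb1 v (lt_of_le_of_lt (Nat.zero_le _) q.2)
  obtain ⟨h1, h2⟩ := awake_imp port ω hnL hv
  rcases Nat.lt_or_ge L t with ht | ht
  · obtain rfl : t = L + 1 := by omega
    obtain ⟨-, e2, -⟩ := run_final (G := G) (w := w) (a := a) (hp0 := hp0) (hp1 := hp1) port ω hnL v
    have hL : ¬ L + 1 ≤ L := by omega
    simp only [levelProgram] at e2 hm
    rw [e2, if_neg hL] at hm
    obtain rfl := Option.some.inj (Option.mem_def.1 hm)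
    simpa using hb
  · have hinv := runInvariant (G := G) (w := w) (a := a) (hp0 := hp0) (hp1 := hp1) port ω hnL ht v
    obtain ⟨-, e2⟩ := hinv.awake h1
    have e3 := hinv.sample
    have e4 := hinv.lvl
    simp only [levelProgram] at e2 e3 e4 hm
    rw [e2, e3, if_pos ht] at hm
    split_ifs at hm with hg
    · obtain rfl := Option.some.inj (Option.mem_def.1 hm)
      rw [encodeLevel]
      split_ifs with hn
      · simpa using hb
      · rw [e4 hg]
        exact hb2 hn _ (hg.trans ht) _ ((level_le _ _).trans ht)
    · exact absurd (Option.mem_def.1 hm).symm (Option.some_ne_none _)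

/-! ### The seed measure as a finite expectation -/

theorem pi_toMeasure_real {α : Type} [Fintype α] [MeasurableSpace α] [DiscreteMeasurableSpace α]
    (μ : PMF α) (A : Set (V → α)) :
    (Measure.pi fun _ : V => μ.toMeasure).real A = prodProb (fun _ a => (μ a).toReal) A := by
  classical
  have h1 : ∀ ω : V → α, (Measure.pi fun _ : V => μ.toMeasure).real {ω}
      = ∏ v, (μ (ω v)).toReal := fun ω => by
    rw [Measure.real, Measure.pi_singleton, ENNReal.toReal_prod]
    refine Finset.prod_congr rfl fun v _ => ?_
    rw [PMF.toMeasure_apply_singleton _ _ (measurableSet_singleton _)]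
  have h2 : (Measure.pi fun _ : V => μ.toMeasure).real A
      = ∑ ω ∈ Finset.univ.filter (· ∈ A), (Measure.pi fun _ : V => μ.toMeasure).real {ω} := by
    rw [sum_measureReal_singleton]
    simp
  rw [h2, prodProb, prodExp, Finset.sum_filter]
  refine Finset.sum_congr rfl fun ω _ => ?_
  rw [h1]
  by_cases h : ω ∈ A <;> simp [h]

theorem seedMeasure_real_eq (A : Set (V → Fin n → Bool)) :
    ((levelProgram w a p hp0 hp1 n L).seedMeasure V).real A
      = prodProb (fun (_ : V) (b : Fin n → Bool) => ∏ j : Fin n, bernoulliLaw (p j) (b j)) A := by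
  have hlaw := isLaw_bernoulliLaw (ι := Fin n) (p := fun j => p j) (fun j => (hp0 j).le)
    (fun j => hp1 j)
  refine (@pi_toMeasure_real V _ _ (Fin n → Bool) _ ⊤ (@DiscreteMeasurableSpace.mk _ ⊤
    fun _ => trivial) (bitsPMF p hp0 hp1 n) A).trans ?_
  congr 1
  funext _ b
  exact ENNReal.toReal_ofReal (Finset.prod_nonneg fun j _ => hlaw.nonneg j _)

/-- Exchanging the order of nodes and bits. -/
theorem prodProb_swap (A : Set (V → Fin n → Bool)) :
    prodProb (fun (_ : V) (b : Fin n → Bool) => ∏ j : Fin n, bernoulliLaw (p j) (b j)) A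
      = prodProb (fun (j : Fin n) (r : V → Bool) => ∏ v, bernoulliLaw (p j) (r v))
        {ω | (fun v j => ω j v) ∈ A} := by
  rw [prodProb, prodExp, prodProb, prodExp]
  refine Fintype.sum_equiv (Equiv.piComm fun _ _ => Bool) _ _ fun ω => ?_
  rw [Finset.prod_comm]
  rfl

end Results

/-! ### The parameters of the program -/

section Parameters

/-- The number of final levels in which all nodes are awake. -/
noncomputable def awakeLevels (ε : ℝ) : ℕ := ⌈1 / ε ^ 3⌉₊

/-- The number of levels. -/
noncomputable def numLevels (ε : ℝ) (D : ℕ) : ℕ := ⌈Real.log D / Real.log (1 + ε)⌉₊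

/-- The number of levels in which only a random sample of the nodes is awake. -/
noncomputable def sampledLevels (ε : ℝ) (D : ℕ) : ℕ := numLevels ε D - awakeLevels ε

/-- The weight of an edge of level `j`. -/
noncomputable def levelWeight (ε : ℝ) (D j : ℕ) : ℝ := (1 + ε) ^ j / (1 + ε) ^ numLevels ε D

/-- The probability with which a node is sampled at level `j`. -/
noncomputable def sampleProb (ε : ℝ) (D j : ℕ) : ℝ :=
  if j < sampledLevels ε D then (awakeLevels ε : ℝ) ^ 2 / ((numLevels ε D : ℝ) - j) ^ 3 else 1

variable {ε : ℝ} {D : ℕ}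

theorem levelWeight_pos (hε : 0 < ε) (j : ℕ) : 0 < levelWeight ε D j := by
  unfold levelWeight
  positivity

theorem levelWeight_mono (hε : 0 < ε) : Monotone (levelWeight ε D) := fun i j h =>
  div_le_div_of_nonneg_right (pow_le_pow_right₀ (by linarith) h) (by positivity)

theorem levelWeight_succ (ε : ℝ) (D j : ℕ) :
    levelWeight ε D (j + 1) = (1 + ε) * levelWeight ε D j := by
  rw [levelWeight, levelWeight, pow_succ]
  ring

theorem levelWeight_numLevels (hε : 0 < ε) : levelWeight ε D (numLevels ε D) = 1 :=
  div_self (by positivity)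

theorem half_le_log_one_add (hε : 0 < ε) (hε' : ε ≤ 1 / 1000) : ε / 2 ≤ Real.log (1 + ε) := by
  have h := Real.one_sub_inv_le_log_of_pos (by linarith : 0 < 1 + ε)
  refine le_trans ?_ h
  rw [show 1 - (1 + ε)⁻¹ = ε / (1 + ε) by field_simp; ring]
  exact div_le_div_of_nonneg_left hε.le (by linarith) (by linarith)

theorem levelWeight_zero_mul_le (hε : 0 < ε) : levelWeight ε D 0 * D ≤ 1 := by
  rw [levelWeight, pow_zero, one_div, inv_mul_le_one₀ (by positivity)]
  rcases Nat.eq_zero_or_pos D with h | h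
  · subst h
    simp only [Nat.cast_zero]
    positivity
  · have hlog : 0 < Real.log (1 + ε) := Real.log_pos (by linarith)
    have h1 : Real.log D ≤ numLevels ε D * Real.log (1 + ε) := by
      rw [← div_le_iff₀ hlog]
      exact Nat.le_ceil _
    rw [← Real.log_pow] at h1
    exact (Real.log_le_log_iff (by exact_mod_cast h) (by positivity)).1 h1

theorem numLevels_le (hε : 0 < ε) (hε' : ε ≤ 1 / 1000) :
    (numLevels ε D : ℝ) ≤ 2 * Real.log D / ε + 1 := by
  have hlog := half_le_log_one_add hε hε'
  have h0 : 0 ≤ Real.log D := Real.log_natCast_nonneg D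
  have h1 : Real.log D / Real.log (1 + ε) ≤ 2 * Real.log D / ε := by
    rw [div_le_div_iff₀ (by linarith) hε]
    nlinarith
  exact (Nat.ceil_lt_add_one (div_nonneg h0 (by linarith))).le.trans (by linarith)

theorem le_awakeLevels (ε : ℝ) : 1 / ε ^ 3 ≤ awakeLevels ε := Nat.le_ceil _

theorem awakeLevels_le (hε : 0 < ε) : (awakeLevels ε : ℝ) ≤ 1 / ε ^ 3 + 1 :=
  (Nat.ceil_lt_add_one (by positivity)).le

theorem one_le_awakeLevels (hε : 0 < ε) : (1 : ℝ) ≤ awakeLevels ε := by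
  have : 0 < awakeLevels ε := Nat.ceil_pos.2 (by positivity)
  exact_mod_cast this

theorem sampledLevels_le (ε : ℝ) (D : ℕ) : sampledLevels ε D ≤ numLevels ε D := Nat.sub_le _ _

theorem awakeLevels_lt_sub {j : ℕ} (hj : j < sampledLevels ε D) :
    (awakeLevels ε : ℝ) < numLevels ε D - j := by
  have : j + awakeLevels ε < numLevels ε D := by
    unfold sampledLevels at hj
    omega
  have h : ((j + awakeLevels ε : ℕ) : ℝ) < numLevels ε D := by exact_mod_cast this
  push_cast at h
  linarith

theorem sampleProb_of_lt {j : ℕ} (hj : j < sampledLevels ε D) :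
    sampleProb ε D j = (awakeLevels ε : ℝ) ^ 2 / ((numLevels ε D : ℝ) - j) ^ 3 := if_pos hj

theorem sampleProb_of_le {j : ℕ} (hj : sampledLevels ε D ≤ j) : sampleProb ε D j = 1 :=
  if_neg (not_lt.2 hj)

theorem sampleProb_pos (hε : 0 < ε) (j : ℕ) : 0 < sampleProb ε D j := by
  rcases Nat.lt_or_ge j (sampledLevels ε D) with h | h
  · rw [sampleProb_of_lt h]
    have h1 := one_le_awakeLevels hε
    have h2 := awakeLevels_lt_sub h
    exact div_pos (by positivity) (pow_pos (by linarith) 3)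
  · rw [sampleProb_of_le h]
    exact one_pos

theorem sampleProb_le_one (hε : 0 < ε) (j : ℕ) : sampleProb ε D j ≤ 1 := by
  rcases Nat.lt_or_ge j (sampledLevels ε D) with h | h
  · rw [sampleProb_of_lt h]
    have h1 := one_le_awakeLevels hε
    have h2 := awakeLevels_lt_sub h
    rw [div_le_one (pow_pos (by linarith) 3)]
    calc (awakeLevels ε : ℝ) ^ 2 ≤ ((numLevels ε D : ℝ) - j) ^ 2 := by gcongr
      _ ≤ ((numLevels ε D : ℝ) - j) ^ 3 := pow_le_pow_right₀ (by linarith) (by norm_num)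
  · rw [sampleProb_of_le h]

theorem sum_inv_sq_le (hε : 0 < ε) :
    ∑ j ∈ Finset.range (sampledLevels ε D), 1 / ((numLevels ε D : ℝ) - j) ^ 2
      ≤ 1 / (awakeLevels ε : ℝ) := by
  have h1 := one_le_awakeLevels hε
  have key : ∀ m ≤ sampledLevels ε D, 0 < sampledLevels ε D →
      ∑ j ∈ Finset.range m, 1 / ((numLevels ε D : ℝ) - j) ^ 2 ≤ 1 / ((numLevels ε D : ℝ) - m) := by
    intro m hm hpos
    induction m with
    | zero =>
      have := awakeLevels_lt_sub hpos
      simp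
    | succ m ih =>
      have h2 := awakeLevels_lt_sub (by omega : m < sampledLevels ε D)
      rw [Finset.sum_range_succ]
      have ih' := ih (by omega)
      push_cast
      have h3 : (awakeLevels ε : ℝ) ≤ numLevels ε D - (m + 1) := by
        have : m + 1 + awakeLevels ε ≤ numLevels ε D := by
          unfold sampledLevels at hm hpos
          omega
        have h : ((m + 1 + awakeLevels ε : ℕ) : ℝ) ≤ numLevels ε D := by exact_mod_cast this
        push_cast at h
        linarith
      set x : ℝ := numLevels ε D - m with hx
      have e : (numLevels ε D : ℝ) - (m + 1) = x - 1 := by rw [hx]; ring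
      rw [e] at h3 ⊢
      have hx1 : 0 < x - 1 := by linarith
      have : 1 / x + 1 / x ^ 2 ≤ 1 / (x - 1) := by
        have hx0 : 0 < x := by linarith
        rw [show 1 / x + 1 / x ^ 2 = (x + 1) / x ^ 2 by field_simp, div_le_div_iff₀ (by positivity) hx1]
        nlinarith
      linarith
  rcases Nat.eq_zero_or_pos (sampledLevels ε D) with h | h
  · rw [h]
    simp
  · refine (key _ le_rfl h).trans (le_of_eq ?_)
    have : awakeLevels ε + sampledLevels ε D = numLevels ε D := by
      unfold sampledLevels at h ⊢
      omega
    rw [← this]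
    push_cast
    ring_nf

theorem pow_eight_le (hε : 0 < ε) (hε' : ε ≤ 1 / 1000) {k : ℕ} (hk : 1 / ε ^ 3 ≤ k) :
    (k : ℝ) ^ 8 ≤ (1 + ε) ^ k := by
  have hk0 : (0 : ℝ) < k := lt_of_lt_of_le (by positivity) hk
  set s : ℝ := (k : ℝ) ^ (1 / 3 : ℝ) with hs
  have hs0 : 0 < s := Real.rpow_pos_of_pos hk0 _
  have hs3 : s ^ 3 = k := by
    rw [hs, ← Real.rpow_natCast, ← Real.rpow_mul hk0.le]
    norm_num
  have hεs : 1 ≤ ε * s := by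
    rw [← hs3, div_le_iff₀ (by positivity)] at hk
    by_contra h
    push Not at h
    have : (ε * s) ^ 3 < 1 := pow_lt_one₀ (by positivity) h (by norm_num)
    rw [mul_pow] at this
    linarith
  have hs1 : 1000 ≤ s := by nlinarith
  rw [← Real.log_le_log_iff (by positivity) (by positivity), Real.log_pow, Real.log_pow]
  have h1 := half_le_log_one_add hε hε'
  have h2 : Real.log k = 3 * Real.log s := by rw [← hs3, Real.log_pow]; norm_num
  have h3 := Real.log_le_sub_one_of_pos hs0
  rw [h2]
  have h4 : (k : ℝ) * (ε / 2) ≤ k * Real.log (1 + ε) := by gcongr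
  have h5 : s ^ 2 / 2 ≤ k * (ε / 2) := by
    rw [← hs3]
    have : s ^ 2 * 1 ≤ s ^ 2 * (ε * s) := by gcongr
    linarith
  push_cast
  nlinarith

theorem levelWeight_le (hε : 0 < ε) (hε' : ε ≤ 1 / 1000) {j : ℕ} (hj : j < sampledLevels ε D) :
    levelWeight ε D j ≤ 1 / ((numLevels ε D : ℝ) - j) ^ 8 := by
  have h1 := awakeLevels_lt_sub hj
  have h0 := one_le_awakeLevels hε
  have hjL : j ≤ numLevels ε D := hj.le.trans (sampledLevels_le _ _)
  have h2 : ((numLevels ε D - j : ℕ) : ℝ) = numLevels ε D - j := Nat.cast_sub hjL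
  have h3 := pow_eight_le hε hε' (k := numLevels ε D - j)
    (by rw [h2]; exact (le_awakeLevels ε).trans h1.le)
  rw [h2] at h3
  have h4 : levelWeight ε D j = 1 / (1 + ε) ^ (numLevels ε D - j) := by
    rw [levelWeight, div_eq_div_iff (by positivity) (by positivity), one_mul, ← pow_add,
      Nat.add_sub_cancel' hjL]
  rw [h4]
  exact one_div_le_one_div_of_le (pow_pos (by linarith) 8) h3

theorem levelWeight_le_sq (hε : 0 < ε) (hε' : ε ≤ 1 / 1000) {j : ℕ}
    (hj : j < sampledLevels ε D) : levelWeight ε D j ≤ sampleProb ε D j ^ 2 := by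
  have h1 := awakeLevels_lt_sub hj
  have h0 := one_le_awakeLevels hε
  refine (levelWeight_le hε hε' hj).trans ?_
  rw [sampleProb_of_lt hj]
  set x : ℝ := numLevels ε D - j
  have hx : 1 ≤ x := by linarith
  rw [div_pow, ← pow_mul, ← pow_mul, div_le_div_iff₀ (by positivity) (by positivity)]
  calc 1 * x ^ (3 * 2) ≤ 1 * x ^ 8 := by gcongr <;> norm_num [hx]
    _ ≤ (awakeLevels ε : ℝ) ^ (2 * 2) * x ^ 8 := by
      gcongr
      exact one_le_pow₀ h0

theorem sum_levelWeight_le (hε : 0 < ε) (hε' : ε ≤ 1 / 1000) :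
    ∑ j ∈ Finset.range (sampledLevels ε D),
      4 * levelWeight ε D j / (sampleProb ε D j ^ 2 * ε ^ 2) ≤ ε := by
  have h0 := one_le_awakeLevels hε
  have hk := le_awakeLevels ε
  set k : ℝ := (awakeLevels ε : ℝ) with hkdef
  have hterm : ∀ j ∈ Finset.range (sampledLevels ε D),
      4 * levelWeight ε D j / (sampleProb ε D j ^ 2 * ε ^ 2)
        ≤ 4 / (k ^ 4 * ε ^ 2) * (1 / ((numLevels ε D : ℝ) - j) ^ 2) := by
    intro j hj
    have hj' := Finset.mem_range.1 hj
    have h1 := awakeLevels_lt_sub hj'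
    have h2 := levelWeight_le hε hε' hj'
    rw [sampleProb_of_lt hj', ← hkdef]
    set x : ℝ := numLevels ε D - j
    have hx : 0 < x := by linarith
    calc 4 * levelWeight ε D j / ((k ^ 2 / x ^ 3) ^ 2 * ε ^ 2)
        ≤ 4 * (1 / x ^ 8) / ((k ^ 2 / x ^ 3) ^ 2 * ε ^ 2) := by gcongr
      _ = _ := by field_simp
  refine (Finset.sum_le_sum hterm).trans ?_
  rw [← Finset.mul_sum]
  have hsum := sum_inv_sq_le (ε := ε) (D := D) hε
  rw [← hkdef] at hsum
  calc 4 / (k ^ 4 * ε ^ 2) * _ ≤ 4 / (k ^ 4 * ε ^ 2) * (1 / k) := by gcongr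
    _ = 4 / (k ^ 5 * ε ^ 2) := by field_simp
    _ ≤ ε := by
      rw [div_le_iff₀ (by positivity)]
      rw [div_le_iff₀ (by positivity)] at hk
      have h4 : 4 ≤ k := by
        have : ε ^ 3 ≤ (1 / 1000) ^ 3 := by gcongr
        nlinarith
      calc (4 : ℝ) ≤ k ^ 4 * 1 := by nlinarith [one_le_pow₀ h0 (n := 3)]
        _ ≤ k ^ 4 * (k * ε ^ 3) := by gcongr
        _ = _ := by ring

end Parameters

section Bounds

variable {V : Type} [Fintype V] [DecidableEq V] {ε : ℝ} {D : ℕ}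

theorem isLaw_bits (hε : 0 < ε) (n : ℕ) : IsLaw (fun (_ : V) (b : Fin n → Bool) =>
    ∏ j : Fin n, bernoulliLaw (sampleProb ε D j) (b j)) := by
  have hlaw := isLaw_bernoulliLaw (ι := Fin n) (p := fun j => sampleProb ε D j)
    (fun j => (sampleProb_pos hε j).le) (fun j => sampleProb_le_one hε j)
  refine ⟨fun _ b => Finset.prod_nonneg fun j _ => hlaw.nonneg j _, fun _ => ?_⟩
  rw [← Fintype.prod_sum]
  exact Finset.prod_eq_one fun j _ => hlaw.sum_eq_one j

theorem sub_sampleLevel_le (hn : 0 < sampledLevels ε D) (b : Fin (sampledLevels ε D) → Bool) :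
    (numLevels ε D : ℝ) + 3 - sampleLevel b ≤ awakeLevels ε + 3
      + ∑ j : Fin (sampledLevels ε D), if b j then (numLevels ε D : ℝ) - j else 0 := by
  have hnn : ∀ j : Fin (sampledLevels ε D), 0 ≤ if b j then (numLevels ε D : ℝ) - j else 0 := by
    intro j
    have := awakeLevels_lt_sub j.2
    have h0 : (0 : ℝ) ≤ awakeLevels ε := Nat.cast_nonneg _
    split_ifs <;> linarith
  have hsum : 0 ≤ ∑ j : Fin (sampledLevels ε D), if b j then (numLevels ε D : ℝ) - j else 0 :=
    Finset.sum_nonneg fun j _ => hnn j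
  rcases (sampleLevel_le b).lt_or_eq with h | h
  · have h1 := Finset.single_le_sum (fun j _ => hnn j) (Finset.mem_univ ⟨sampleLevel b, h⟩)
    rw [if_pos (apply_sampleLevel b h)] at h1
    have h0 : (0 : ℝ) ≤ awakeLevels ε := Nat.cast_nonneg _
    simp only at h1
    linarith
  · have h2 : sampledLevels ε D + awakeLevels ε = numLevels ε D := by
      unfold sampledLevels at hn ⊢
      omega
    rw [h, ← h2]
    push_cast
    rw [← h2] at hsum
    push_cast at hsum
    linarith

theorem prodExp_sub_sampleLevel_le (hε : 0 < ε) (hn : 0 < sampledLevels ε D) :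
    prodExp (fun (_ : V) (b : Fin (sampledLevels ε D) → Bool) =>
        ∏ j : Fin (sampledLevels ε D), bernoulliLaw (sampleProb ε D j) (b j))
      (fun ω => ∑ v, ((numLevels ε D : ℝ) + 3 - sampleLevel (ω v)))
      ≤ Fintype.card V * (2 * awakeLevels ε + 3) := by
  have hlaw := isLaw_bernoulliLaw (ι := Fin (sampledLevels ε D)) (p := fun j => sampleProb ε D j)
    (fun j => (sampleProb_pos hε j).le) (fun j => sampleProb_le_one hε j)
  rw [prodExp_sum, ← nsmul_eq_mul, ← Finset.card_univ]
  refine Finset.sum_le_card_nsmul _ _ _ fun v _ => ?_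
  rw [prodExp_eval (isLaw_bits hε _) v
    (fun b => (numLevels ε D : ℝ) + 3 - sampleLevel b)]
  change prodExp (fun j : Fin (sampledLevels ε D) => bernoulliLaw (sampleProb ε D j))
    (fun b => (numLevels ε D : ℝ) + 3 - sampleLevel b) ≤ _
  refine (prodExp_mono hlaw fun b => sub_sampleLevel_le hn b).trans ?_
  rw [prodExp_add, prodExp_const hlaw, prodExp_sum]
  have h1 : ∀ j : Fin (sampledLevels ε D),
      prodExp (fun j : Fin (sampledLevels ε D) => bernoulliLaw (sampleProb ε D j))
        (fun b => if b j then (numLevels ε D : ℝ) - j else 0)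
      = (awakeLevels ε : ℝ) ^ 2 * (1 / ((numLevels ε D : ℝ) - j) ^ 2) := by
    intro j
    rw [prodExp_eval hlaw j (fun x => if x then (numLevels ε D : ℝ) - j else 0)]
    have h2 := awakeLevels_lt_sub j.2
    have h3 := one_le_awakeLevels hε
    have : (numLevels ε D : ℝ) - j ≠ 0 := by linarith
    simp only [Fintype.sum_bool, bernoulliLaw, if_true, Bool.false_eq_true, if_false, mul_zero,
      add_zero]
    rw [sampleProb_of_lt j.2]
    field_simp
  rw [Finset.sum_congr rfl fun j _ => h1 j, ← Finset.mul_sum,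
    Fin.sum_univ_eq_sum_range (fun j : ℕ => 1 / ((numLevels ε D : ℝ) - j) ^ 2)]
  have h4 := sum_inv_sq_le (ε := ε) (D := D) hε
  have h5 := one_le_awakeLevels hε
  have h6 : (awakeLevels ε : ℝ) ^ 2
      * ∑ j ∈ Finset.range (sampledLevels ε D), 1 / ((numLevels ε D : ℝ) - j) ^ 2
      ≤ (awakeLevels ε : ℝ) ^ 2 * (1 / awakeLevels ε) := by gcongr
  rw [show (awakeLevels ε : ℝ) ^ 2 * (1 / awakeLevels ε) = awakeLevels ε by field_simp] at h6
  linarith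

theorem prodProb_awake_le [Nonempty V] (hε : 0 < ε) (hn : 0 < sampledLevels ε D) :
    prodProb (fun (_ : V) (b : Fin (sampledLevels ε D) → Bool) =>
        ∏ j : Fin (sampledLevels ε D), bernoulliLaw (sampleProb ε D j) (b j))
      {ω | (Fintype.card V * (3 * awakeLevels ε + 3) : ℝ)
        ≤ ∑ v, ((numLevels ε D : ℝ) + 3 - sampleLevel (ω v))}
      ≤ Real.exp (-(Fintype.card V * (awakeLevels ε : ℝ) ^ 2
        / (2 * ((numLevels ε D : ℝ) + 3) ^ 2))) := by
  have hP := isLaw_bits (V := V) (D := D) hε (sampledLevels ε D)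
  have hcard : (0 : ℝ) < Fintype.card V := by exact_mod_cast Fintype.card_pos
  have hk := one_le_awakeLevels hε
  have key := prodProb_ge_le hP
    (f := fun ω => ∑ v, ((numLevels ε D : ℝ) + 3 - sampleLevel (ω v)))
    (c := fun _ => (numLevels ε D : ℝ) + 3) (t := Fintype.card V * awakeLevels ε)
    (V := Fintype.card V * ((numLevels ε D : ℝ) + 3) ^ 2) (fun i ω a b => by
      rw [← Finset.sum_sub_distrib, Finset.sum_eq_single i]
      · have h1 : ∀ x : Fin (sampledLevels ε D) → Bool, (sampleLevel x : ℝ) ≤ numLevels ε D :=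
          fun x => by exact_mod_cast (sampleLevel_le x).trans (sampledLevels_le ε D)
        have h2 : ∀ x : Fin (sampledLevels ε D) → Bool, (0 : ℝ) ≤ sampleLevel x :=
          fun x => Nat.cast_nonneg _
        simp only [Function.update_self]
        rw [abs_le]
        constructor <;> linarith [h1 a, h1 b, h2 a, h2 b]
      · intro v _ hv
        rw [Function.update_of_ne hv, Function.update_of_ne hv, sub_self]
      · intro h
        exact absurd (Finset.mem_univ i) h) (by positivity) (by simp) (by positivity)
  refine (prodProb_mono hP fun ω hω => ?_).trans (key.trans (Real.exp_le_exp.2 (le_of_eq ?_)))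
  · have h1 := prodExp_sub_sampleLevel_le (V := V) (D := D) hε hn
    have h2 : (Fintype.card V * (3 * awakeLevels ε + 3) : ℝ)
        ≤ ∑ v, ((numLevels ε D : ℝ) + 3 - sampleLevel (ω v)) := hω
    exact le_trans (by linarith) h2
  · field_simp

/-- If some levels are sampled, then `1 / ε` is small compared to `log D`. -/
theorem sampled_regime {M : ℝ} (hε : 0 < ε) (hε' : ε ≤ 1 / 1000) (hD : 3 * Real.log D ≤ M)
    (hn : 0 < sampledLevels ε D) :
    1 / ε ^ 2 ≤ M ∧ (numLevels ε D : ℝ) ≤ M / ε ∧ 1 ≤ M := by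
  have h1 := awakeLevels_lt_sub hn
  have h2 := le_awakeLevels ε
  have h3 := numLevels_le (D := D) hε hε'
  have h4 : 1 / ε ^ 3 ≤ 2 * Real.log D / ε + 1 := by
    simp only [Nat.cast_zero, sub_zero] at h1
    linarith
  have h5 : 1 / ε ^ 2 ≤ 2 * Real.log D + ε := by
    have := mul_le_mul_of_nonneg_right h4 hε.le
    have e1 : 1 / ε ^ 3 * ε = 1 / ε ^ 2 := by field_simp
    have e2 : (2 * Real.log D / ε + 1) * ε = 2 * Real.log D + ε := by field_simp
    linarith
  have h6 : 100 ≤ 1 / ε ^ 2 := by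
    rw [le_div_iff₀ (by positivity)]
    nlinarith
  have h7 : 1 ≤ Real.log D := by linarith
  refine ⟨by linarith, h3.trans ?_, by linarith⟩
  rw [le_div_iff₀ hε, add_mul, div_mul_cancel₀ _ hε.ne']
  linarith

end Bounds

section Numerics

/-- The numerical inequalities behind the bounds for the probabilities. -/
theorem exponent_bounds {ε c l m k L n : ℝ} (hε : 0 < ε) (h4 : ε ≤ 1) (hc : 1 ≤ c) (hl : 1 / 2 ≤ l)
    (hm : 10 ^ 12 * c ^ 8 * l ^ 18 ≤ m) (hreg : 1 / ε ^ 2 ≤ 3 * c * l) (hL0 : 1 ≤ L)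
    (hL : L ≤ 3 * c * l / ε) (hk : 1 / ε ^ 3 ≤ k) (hn0 : 0 < n) (hnL : n ≤ L) :
    20 * l ≤ (ε / n) ^ 2 * m * ε ^ 2 * (k ^ 2 / L ^ 3) ^ 2 / (8 * (320 * l)) ∧
    20 * l ≤ m * k ^ 2 / (2 * (L + 3) ^ 2) ∧ L ≤ m := by
  have hl0 : 0 < l := by linarith
  have hm0 : 0 < m := lt_of_lt_of_le (by positivity) hm
  have hεL : ε * L ≤ 3 * c * l := by
    rw [le_div_iff₀ hε] at hL
    linarith
  have hεk : 1 ≤ ε ^ 3 * k := by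
    rw [div_le_iff₀ (by positivity)] at hk
    linarith
  have hk0 : 0 < k := lt_of_lt_of_le (by positivity) hk
  have hpow : ∀ i : ℕ, 1 ≤ (2 * l) ^ i := fun i => one_le_pow₀ (by linarith)
  have hcpow : ∀ i : ℕ, 1 ≤ c ^ i := fun i => one_le_pow₀ hc
  refine ⟨?_, ?_, ?_⟩
  · have h1 : (ε / L) ^ 2 * m * ε ^ 2 * (k ^ 2 / L ^ 3) ^ 2 / (8 * (320 * l))
        ≤ (ε / n) ^ 2 * m * ε ^ 2 * (k ^ 2 / L ^ 3) ^ 2 / (8 * (320 * l)) := by gcongr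
    refine le_trans ?_ h1
    have e : (ε / L) ^ 2 * m * ε ^ 2 * (k ^ 2 / L ^ 3) ^ 2 / (8 * (320 * l))
        = m * (ε ^ 3 * k) ^ 4 / ((ε * L) ^ 8 * (2560 * l)) := by
      field_simp
      ring
    rw [e, le_div_iff₀ (by positivity)]
    calc 20 * l * ((ε * L) ^ 8 * (2560 * l)) ≤ 20 * l * ((3 * c * l) ^ 8 * (2560 * l)) := by gcongr
      _ = 335923200 * c ^ 8 * l ^ 10 * 1 := by ring
      _ ≤ 335923200 * c ^ 8 * l ^ 10 * (2 * l) ^ 8 := by gcongr; exact hpow 8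
      _ = 85996339200 * c ^ 8 * l ^ 18 := by ring
      _ ≤ 10 ^ 12 * c ^ 8 * l ^ 18 := by gcongr; norm_num
      _ ≤ m * 1 := by linarith
      _ ≤ m * (ε ^ 3 * k) ^ 4 := by gcongr; exact one_le_pow₀ hεk
  · have h1 : (L + 3) ^ 2 ≤ 16 * L ^ 2 := by nlinarith
    rw [le_div_iff₀ (by positivity)]
    have h2 : ε ^ 2 * (20 * l * (2 * (L + 3) ^ 2)) ≤ ε ^ 2 * (m * k ^ 2) := by
      have h3 : 1 ≤ ε ^ 2 * k ^ 2 := by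
        have : 1 ≤ ε * k := hεk.trans (by
          have : ε ^ 3 ≤ ε := by simpa using pow_le_pow_of_le_one hε.le h4 (by norm_num : 1 ≤ 3)
          gcongr)
        rw [← mul_pow]
        exact one_le_pow₀ this
      calc ε ^ 2 * (20 * l * (2 * (L + 3) ^ 2)) ≤ ε ^ 2 * (20 * l * (2 * (16 * L ^ 2))) := by gcongr
        _ = 640 * l * (ε * L) ^ 2 := by ring
        _ ≤ 640 * l * (3 * c * l) ^ 2 := by gcongr
        _ = 5760 * c ^ 2 * l ^ 3 * 1 := by ring
        _ ≤ 5760 * c ^ 2 * l ^ 3 * (2 * l) ^ 15 := by gcongr; exact hpow 15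
        _ = 188743680 * (c ^ 2 * 1) * l ^ 18 := by ring
        _ ≤ 10 ^ 12 * (c ^ 2 * c ^ 6) * l ^ 18 := by
          gcongr
          · norm_num
          · exact hcpow 6
        _ = 10 ^ 12 * c ^ 8 * l ^ 18 := by ring
        _ ≤ m * 1 := by linarith
        _ ≤ m * (ε ^ 2 * k ^ 2) := by gcongr
        _ = ε ^ 2 * (m * k ^ 2) := by ring
    exact le_of_mul_le_mul_left h2 (by positivity)
  · have h1 : 1 / ε ≤ 1 / ε ^ 2 := by
      refine one_div_le_one_div_of_le (by positivity) ?_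
      nlinarith
    calc L ≤ 3 * c * l * (1 / ε) := by rw [mul_one_div]; exact hL
      _ ≤ 3 * c * l * (3 * c * l) := by gcongr; exact h1.trans hreg
      _ = 9 * (c ^ 2 * 1) * l ^ 2 * 1 := by ring
      _ ≤ 9 * (c ^ 2 * c ^ 6) * l ^ 2 * (2 * l) ^ 16 := by
        gcongr
        · exact hcpow 6
        · exact hpow 16
      _ = 589824 * c ^ 8 * l ^ 18 := by ring
      _ ≤ 10 ^ 12 * c ^ 8 * l ^ 18 := by gcongr; norm_num
      _ ≤ m := hm

end Numerics

section Final

variable {V : Type} [Fintype V] [DecidableEq V] {G : SimpleGraph V} [DecidableRel G.Adj]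

theorem prodProb_compl {ι α : Type} [Fintype ι] [DecidableEq ι] [Fintype α] {P : ι → α → ℝ}
    (hP : IsLaw P) (A : Set (ι → α)) : prodProb P Aᶜ = 1 - prodProb P A := by
  rw [prodProb, prodProb, ← prodExp_const hP 1, ← prodExp_sub]
  congr 1
  funext ω
  by_cases h : ω ∈ A <;> simp [h]

theorem log_degree_bound_le {D Δ c : ℕ} (h : D ≤ Δ ^ c) : Real.log D ≤ c * Real.log Δ := by
  rcases Nat.eq_zero_or_pos D with h0 | h0
  · subst h0
    simpa using mul_nonneg (Nat.cast_nonneg c) (Real.log_natCast_nonneg Δ)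
  · rw [← Real.log_pow]
    exact Real.log_le_log (by exact_mod_cast h0) (by exact_mod_cast h)

theorem length_bits_pair_le {n L g l : ℕ} (hn : 2 ≤ n) (hL : L ≤ n) (hg : g ≤ L) (hl : l ≤ L) :
    ((Nat.bits (Nat.pair g l)).length : ℝ) ≤ 12 * Real.log n := by
  have h1 : Nat.pair g l < 2 ^ (4 * n.size) := by
    calc Nat.pair g l < (max g l + 1) ^ 2 := Nat.pair_lt_max_add_one_sq g l
      _ ≤ (n * n) ^ 2 := Nat.pow_le_pow_left (by
          have : max g l ≤ n := (max_le hg hl).trans hL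
          nlinarith) 2
      _ = n ^ 4 := by ring
      _ ≤ (2 ^ n.size) ^ 4 := Nat.pow_le_pow_left (Nat.lt_size_self n).le 4
      _ = 2 ^ (4 * n.size) := by rw [← pow_mul, mul_comm]
  have h2 : (Nat.bits (Nat.pair g l)).length ≤ 4 * n.size := by
    rw [Nat.size_eq_bits_len]
    exact Nat.size_le.2 h1
  have h3 : 2 ^ (n.size - 1) ≤ n := by
    refine Nat.lt_size.1 ?_
    have : 0 < n.size := Nat.size_pos.2 (by omega)
    omega
  have h4 : ((n.size - 1 : ℕ) : ℝ) * Real.log 2 ≤ Real.log n := by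
    rw [← Real.log_pow]
    refine Real.log_le_log (by positivity) ?_
    exact_mod_cast h3
  have h5 : Real.log 2 ≤ Real.log n := Real.log_le_log (by norm_num) (by exact_mod_cast hn)
  have h6 : (n.size : ℝ) ≤ ((n.size - 1 : ℕ) : ℝ) + 1 := by
    have : n.size ≤ n.size - 1 + 1 := by omega
    exact_mod_cast this
  have h7 : ((Nat.bits (Nat.pair g l)).length : ℝ) ≤ 4 * n.size := by exact_mod_cast h2
  have h8 := Real.log_two_gt_d9
  have h9 : (0 : ℝ) ≤ ((n.size - 1 : ℕ) : ℝ) := Nat.cast_nonneg _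
  nlinarith

/-- If some level is sampled, then the network is large enough for concentration. -/
theorem sampled_case_bounds [Nonempty V] {ε : ℝ} (hε : 0 < ε) (hε' : ε ≤ 1 / 1000)
    {c D : ℕ} (hc : 1 ≤ c) (hD' : D ≤ G.maxDegree ^ c)
    (hm : 10 ^ 12 * (c : ℝ) ^ 8 * Real.log (Fintype.card V) ^ 18 ≤ maxFractionalMatching G)
    (hn : 0 < sampledLevels ε D) :
    2 ≤ Fintype.card V ∧ 1 / 2 ≤ Real.log (Fintype.card V) ∧
    20 * Real.log (Fintype.card V) ≤ (ε / sampledLevels ε D) ^ 2 * maxFractionalMatching G * ε ^ 2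
      * ((awakeLevels ε : ℝ) ^ 2 / (numLevels ε D : ℝ) ^ 3) ^ 2
      / (8 * (320 * Real.log (Fintype.card V))) ∧
    20 * Real.log (Fintype.card V) ≤ maxFractionalMatching G * (awakeLevels ε : ℝ) ^ 2
      / (2 * ((numLevels ε D : ℝ) + 3) ^ 2) ∧
    numLevels ε D ≤ maxFractionalMatching G ∧ maxFractionalMatching G ≤ Fintype.card V := by
  have hl0 : 0 ≤ Real.log (Fintype.card V) := Real.log_natCast_nonneg _
  have hΔ : Real.log G.maxDegree ≤ Real.log (Fintype.card V) := by
    rcases Nat.eq_zero_or_pos G.maxDegree with h | h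
    · simpa [h] using hl0
    · exact Real.log_le_log (by exact_mod_cast h) (by exact_mod_cast G.maxDegree_lt_card_verts.le)
  have hc1 : (1 : ℝ) ≤ c := by exact_mod_cast hc
  have hlogD : 3 * Real.log D ≤ 3 * c * Real.log (Fintype.card V) := by
    have h1 := log_degree_bound_le hD'
    have h2 : (c : ℝ) * Real.log G.maxDegree ≤ c * Real.log (Fintype.card V) := by gcongr
    linarith
  obtain ⟨hr1, hr2, hr3⟩ := sampled_regime hε hε' hlogD hn
  have hlpos : 0 < Real.log (Fintype.card V) := by
    rcases hl0.lt_or_eq with h | h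
    · exact h
    · rw [← h] at hr3
      norm_num at hr3
  have hN2 : 2 ≤ Fintype.card V := by
    have h1 : (1 : ℝ) < Fintype.card V := (Real.log_pos_iff (Nat.cast_nonneg _)).1 hlpos
    exact_mod_cast h1
  have hl2 : 1 / 2 ≤ Real.log (Fintype.card V) := by
    have h1 := Real.log_two_gt_d9
    have h2 : Real.log 2 ≤ Real.log (Fintype.card V) :=
      Real.log_le_log (by norm_num) (by exact_mod_cast hN2)
    linarith
  have hnL : (sampledLevels ε D : ℝ) ≤ numLevels ε D := by exact_mod_cast sampledLevels_le ε D
  have hn0 : (1 : ℝ) ≤ sampledLevels ε D := by exact_mod_cast hn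
  obtain ⟨hb1, hb2, hb3⟩ := exponent_bounds hε (by linarith : ε ≤ 1) hc1 hl2 hm hr1
    (hn0.trans hnL) hr2 (le_awakeLevels ε) (by linarith) hnL
  refine ⟨hN2, hl2, hb1, hb2, hb3, ?_⟩
  have := maxFractionalMatching_le_card G Finset.univ fun u v _ => Or.inl (Finset.mem_univ u)
  rwa [Finset.card_univ] at this

theorem union_bound_le {N : ℝ} (hN : 2 ≤ N) :
    N * (N * (1 / N ^ 20) + 1 / N ^ 20) + 1 / N ^ 20 ≤ 1 / N ^ 5 := by
  have h0 : 0 < N := by linarith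
  have h1 : N * N + N + 1 ≤ N ^ 4 := by
    have h2 : 0 ≤ (N ^ 2 - 4) * N ^ 2 := mul_nonneg (by nlinarith) (by positivity)
    nlinarith
  have h3 : N * (N * (1 / N ^ 20) + 1 / N ^ 20) + 1 / N ^ 20 = (N * N + N + 1) / N ^ 20 := by ring
  rw [h3, div_le_div_iff₀ (by positivity) (by positivity), one_mul]
  calc (N * N + N + 1) * N ^ 5 ≤ N ^ 4 * N ^ 5 := mul_le_mul_of_nonneg_right h1 (by positivity)
    _ = N ^ 9 := by ring
    _ ≤ N ^ 20 := pow_le_pow_right₀ (by linarith) (by norm_num)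

/-- If the penalties are small and the nodes are rarely awake, the program succeeds. -/
theorem program_succeeds [Nonempty V] {ε : ℝ} (hε : 0 < ε) (hε' : ε ≤ 1 / 1000) {D : ℕ}
    (hD : G.maxDegree ≤ D) (port : PortNumbering G) (ω : V → Fin (sampledLevels ε D) → Bool)
    (hex : ∑ j ∈ Finset.range (numLevels ε D), ∑ v, excess ε (deviation G (levelWeight ε D)
        (seedLevel G (levelWeight ε D) (1 - 2 * ε) (sampleProb ε D) ω j)
        (fun v => sampleFactor (sampleProb ε D) (sampleLevel (ω v)) j) v)
      ≤ 2 * ε * ∑ v, load G (levelWeight ε D)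
          (seedLevel G (levelWeight ε D) (1 - 2 * ε) (sampleProb ε D) ω (numLevels ε D)) v
        + ε * maxFractionalMatching G)
    (haw : ∑ v, ((numLevels ε D : ℝ) + 3 - sampleLevel (ω v))
      ≤ Fintype.card V * (3 * awakeLevels ε + 3)) :
    (∃ x, IsFractionalMatching G x ∧
      (levelProgram (levelWeight ε D) (1 - 2 * ε) (sampleProb ε D) (sampleProb_pos hε)
        (sampleProb_le_one hε) (sampledLevels ε D) (numLevels ε D)).Outputs port ω
          (numLevels ε D + 2) x ∧
      maxFractionalMatching G ≤ (2 + 100 * ε) * fractionalSize G x) ∧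
    (levelProgram (levelWeight ε D) (1 - 2 * ε) (sampleProb ε D) (sampleProb_pos hε)
        (sampleProb_le_one hε) (sampledLevels ε D) (numLevels ε D)).avgAwakeComplexity port ω
      ≤ 10 ^ 12 / ε ^ 3 := by
  have hnL := sampledLevels_le ε D
  refine ⟨⟨_, isFractionalMatching_prunedWeights (levelWeight_pos hε) _,
    levelProgram_outputs port ω hnL, ?_⟩, ?_⟩
  · exact maxFractionalMatching_le_of_excess hε hε' (levelWeight_pos hε) (levelWeight_mono hε)
      (fun i => (levelWeight_succ ε D i).le) (levelWeight_numLevels hε)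
      (levelWeight_zero_mul_le hε) hD hex
  · have hcard : (0 : ℝ) < Fintype.card V := by exact_mod_cast Fintype.card_pos
    refine (div_le_iff₀ hcard).2 ?_
    have h1 : ∀ v, ((levelProgram (levelWeight ε D) (1 - 2 * ε) (sampleProb ε D)
        (sampleProb_pos hε) (sampleProb_le_one hε) (sampledLevels ε D)
        (numLevels ε D)).awakeComplexity port ω v : ℝ)
        ≤ (numLevels ε D : ℝ) + 3 - sampleLevel (ω v) := fun v => by
      have h := levelProgram_awakeComplexity_le (w := levelWeight ε D) (a := 1 - 2 * ε)
        (p := sampleProb ε D) (hp0 := sampleProb_pos hε) (hp1 := sampleProb_le_one hε) port ω hnL v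
      have h' : sampleLevel (ω v) ≤ numLevels ε D + 3 :=
        ((sampleLevel_le _).trans hnL).trans (Nat.le_add_right _ _)
      have := (Nat.cast_le (α := ℝ)).2 h
      rw [Nat.cast_sub h'] at this
      exact_mod_cast this
    refine ((Finset.sum_le_sum fun v _ => h1 v).trans haw).trans ?_
    rw [mul_comm]
    refine mul_le_mul_of_nonneg_right ?_ hcard.le
    have h2 := awakeLevels_le hε
    have h3 : 1 ≤ 1 / ε ^ 3 := by
      rw [le_div_iff₀ (by positivity), one_mul]
      exact pow_le_one₀ hε.le (by linarith)
    rw [div_eq_mul_one_div]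
    linarith

theorem prodProb_program_succeeds [Nonempty V] {ε : ℝ} (hε : 0 < ε) (hε' : ε ≤ 1 / 1000)
    {c D : ℕ} (hc : 1 ≤ c) (hD : G.maxDegree ≤ D) (hD' : D ≤ G.maxDegree ^ c)
    (hm : 10 ^ 12 * (c : ℝ) ^ 8 * Real.log (Fintype.card V) ^ 18 ≤ maxFractionalMatching G) :
    1 - 1 / (Fintype.card V : ℝ) ^ 5 ≤
      prodProb (fun (_ : V) (b : Fin (sampledLevels ε D) → Bool) =>
          ∏ j : Fin (sampledLevels ε D), bernoulliLaw (sampleProb ε D j) (b j))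
        {ω | (∑ j ∈ Finset.range (numLevels ε D), ∑ v, excess ε (deviation G (levelWeight ε D)
              (seedLevel G (levelWeight ε D) (1 - 2 * ε) (sampleProb ε D) ω j)
              (fun v => sampleFactor (sampleProb ε D) (sampleLevel (ω v)) j) v)
            ≤ 2 * ε * ∑ v, load G (levelWeight ε D)
                (seedLevel G (levelWeight ε D) (1 - 2 * ε) (sampleProb ε D) ω (numLevels ε D)) v
              + ε * maxFractionalMatching G) ∧
          ∑ v, ((numLevels ε D : ℝ) + 3 - sampleLevel (ω v))
            ≤ Fintype.card V * (3 * awakeLevels ε + 3)} := by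
  have hP := isLaw_bits (V := V) (D := D) hε (sampledLevels ε D)
  have hcard : (1 : ℝ) ≤ Fintype.card V := by exact_mod_cast Fintype.card_pos (α := V)
  set N : ℝ := (Fintype.card V : ℝ) with hN
  set l := Real.log N with hl
  set m := maxFractionalMatching G with hmdef
  have hl0 : 0 ≤ l := Real.log_nonneg hcard
  have hm0 : 0 ≤ m := le_trans (by positivity) hm
  rcases Nat.eq_zero_or_pos (sampledLevels ε D) with hn | hn
  · have h1 : ∀ ω : V → Fin (sampledLevels ε D) → Bool, ∀ v, sampleLevel (ω v) = 0 := fun ω v => by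
      have := sampleLevel_le (ω v)
      omega
    rw [Set.eq_univ_of_forall (s := {ω | _ ∧ _})]
    · have h2 : prodProb (fun (_ : V) (b : Fin (sampledLevels ε D) → Bool) =>
          ∏ j : Fin (sampledLevels ε D), bernoulliLaw (sampleProb ε D j) (b j)) Set.univ = 1 := by
        rw [prodProb, Set.indicator_univ]
        exact prodExp_const hP 1
      rw [h2]
      have : 0 ≤ 1 / N ^ 5 := by positivity
      linarith
    · intro ω
      refine ⟨?_, ?_⟩
      · rw [Finset.sum_eq_zero fun j _ => Finset.sum_eq_zero fun v _ => ?_]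
        · have : 0 ≤ ∑ v, load G (levelWeight ε D) (seedLevel G (levelWeight ε D) (1 - 2 * ε)
              (sampleProb ε D) ω (numLevels ε D)) v :=
            Finset.sum_nonneg fun v _ => load_nonneg (levelWeight_pos hε) _ v
          positivity
        · rw [deviation_one, excess_zero]
          exact fun u => sampleFactor_eq_one (n := sampledLevels ε D)
            (fun j hj => sampleProb_of_le hj) _ (by omega)
      · simp only [h1]
        rw [Finset.sum_const, Finset.card_univ, nsmul_eq_mul, ← hN]
        have h2 : numLevels ε D ≤ awakeLevels ε := by
          unfold sampledLevels at hn
          omega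
        have h3 : (numLevels ε D : ℝ) ≤ awakeLevels ε := by exact_mod_cast h2
        have h4 := one_le_awakeLevels hε
        refine mul_le_mul_of_nonneg_left ?_ (by linarith)
        push_cast
        linarith
  · obtain ⟨hN2, hl2, hb1, hb2, hLm, hmN⟩ := sampled_case_bounds hε hε' hc hD' hm hn
    rw [← hN, ← hl, ← hmdef] at hb1 hb2
    rw [← hN, ← hl] at hl2
    rw [← hmdef] at hLm hmN
    rw [← hN] at hmN
    have hnL : (sampledLevels ε D : ℝ) ≤ numLevels ε D := by exact_mod_cast sampledLevels_le ε D
    have hn0 : (1 : ℝ) ≤ sampledLevels ε D := by exact_mod_cast hn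
    have hk := one_le_awakeLevels hε
    have hmpos : 0 < m := by linarith
    set E := Real.exp (-(20 * l)) with hE
    have hE20 : E = 1 / N ^ 20 := by
      rw [hE, Real.exp_neg, one_div, hl]
      congr 1
      rw [show 20 * Real.log N = Real.log (N ^ 20) by rw [Real.log_pow]; norm_num,
        Real.exp_log (by positivity)]
    have hbad1 := prodProb_excess_sum_le (G := G) (w := levelWeight ε D) (p := sampleProb ε D)
      (ε := ε) (m := m) (Y := 320 * l) (q := (awakeLevels ε : ℝ) ^ 2 / (numLevels ε D : ℝ) ^ 3)
      (n := sampledLevels ε D) (D := D) (L := numLevels ε D) hε hε' (levelWeight_pos hε)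
      (levelWeight_mono hε) (fun i => (levelWeight_succ ε D i).le) (levelWeight_zero_mul_le hε) hD
      (sampleProb_pos hε) (sampleProb_le_one hε) (fun j hj => sampleProb_of_le hj) hn
      (sampledLevels_le ε D) hmpos (by linarith)
      (div_pos (by positivity) (pow_pos (by linarith) 3)) (fun j hj => by
        rw [sampleProb_of_lt hj]
        have h1 := awakeLevels_lt_sub hj
        have h2 : (0 : ℝ) ≤ j := Nat.cast_nonneg j
        refine div_le_div_of_nonneg_left (by positivity) (pow_pos (by linarith) 3) ?_
        exact pow_le_pow_left₀ (by linarith) (by linarith) 3)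
      (fun j hj => levelWeight_le_sq hε hε' hj) (sum_levelWeight_le hε hε')
    have hbad2 := prodProb_awake_le (V := V) (D := D) hε hn
    rw [← hN] at hbad1 hbad2
    have e1 : Real.exp (-(320 * l / 16)) ≤ E := Real.exp_le_exp.2 (by linarith)
    have e2 : Real.exp (-((ε / sampledLevels ε D) ^ 2 * m * ε ^ 2
        * ((awakeLevels ε : ℝ) ^ 2 / (numLevels ε D : ℝ) ^ 3) ^ 2 / (8 * (320 * l)))) ≤ E :=
      Real.exp_le_exp.2 (by linarith)
    have e3 : Real.exp (-(N * (awakeLevels ε : ℝ) ^ 2 / (2 * ((numLevels ε D : ℝ) + 3) ^ 2)))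
        ≤ E := by
      refine Real.exp_le_exp.2 (neg_le_neg (hb2.trans ?_))
      gcongr
    have hE0 : 0 < E := Real.exp_pos _
    have hbad1' := hbad1.trans (calc
      (sampledLevels ε D : ℝ) * (N * Real.exp (-(320 * l / 16)) + _) ≤ N * (N * E + E) := by
        gcongr
        linarith)
    have hbad2' := hbad2.trans e3
    have hsub := prodProb_mono hP (A := {ω | (∑ j ∈ Finset.range (numLevels ε D), ∑ v, excess ε
              (deviation G (levelWeight ε D)
              (seedLevel G (levelWeight ε D) (1 - 2 * ε) (sampleProb ε D) ω j)
              (fun v => sampleFactor (sampleProb ε D) (sampleLevel (ω v)) j) v)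
            ≤ 2 * ε * ∑ v, load G (levelWeight ε D)
                (seedLevel G (levelWeight ε D) (1 - 2 * ε) (sampleProb ε D) ω (numLevels ε D)) v
              + ε * m) ∧
          ∑ v, ((numLevels ε D : ℝ) + 3 - sampleLevel (ω v))
            ≤ N * (3 * awakeLevels ε + 3)}ᶜ)
      (B := {ω | ¬ ∑ j ∈ Finset.range (numLevels ε D), ∑ v, excess ε
              (deviation G (levelWeight ε D)
              (seedLevel G (levelWeight ε D) (1 - 2 * ε) (sampleProb ε D) ω j)
              (fun v => sampleFactor (sampleProb ε D) (sampleLevel (ω v)) j) v)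
            ≤ 2 * ε * ∑ v, load G (levelWeight ε D)
                (seedLevel G (levelWeight ε D) (1 - 2 * ε) (sampleProb ε D) ω (numLevels ε D)) v
              + ε * m} ∪
        {ω | N * (3 * awakeLevels ε + 3) ≤ ∑ v, ((numLevels ε D : ℝ) + 3 - sampleLevel (ω v))})
      (fun ω hω => by
        by_contra h
        obtain ⟨h1, h2⟩ := not_or.1 h
        exact hω ⟨not_not.1 h1, (not_le.1 h2).le⟩)
    have hu := hsub.trans (prodProb_union_le hP _ _)
    rw [prodProb_compl hP, prodProb_swap (p := sampleProb ε D)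
      {ω | ¬ ∑ j ∈ Finset.range (numLevels ε D), _ ≤ _}] at hu
    have hfin := union_bound_le (N := N) (by rw [hN]; exact_mod_cast hN2)
    rw [← hE20] at hfin
    have hb : prodProb (fun (j : Fin (sampledLevels ε D)) (r : V → Bool) =>
        ∏ v, bernoulliLaw (sampleProb ε D j) (r v)) _ ≤ N * (N * E + E) := hbad1'
    have := hu.trans (add_le_add hb hbad2')
    linarith

end Final

theorem mainTheorem4 (c : ℕ) (hc : 1 ≤ c) :
    ∃ K : ℝ, 0 < K ∧ ∀ ε : ℝ, 0 < ε → ε ≤ 1 / 1000 →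
      -- the node program may use an estimate `N` of the number of nodes
      -- and an estimate `D` of the maximum degree
      ∃ P : (N D : ℕ) → NodeProgram,
        ∀ (V : Type) [Fintype V] [DecidableEq V] [Nonempty V]
          (G : SimpleGraph V) [DecidableRel G.Adj] (port : PortNumbering G) (N D : ℕ),
          Fintype.card V ≤ N → N ≤ Fintype.card V ^ c →
          G.maxDegree ≤ D → D ≤ G.maxDegree ^ c →
          K * Real.log (Fintype.card V) ^ 18 ≤ maxFractionalMatching G →
          ∃ T : ℕ, (T : ℝ) ≤ K * (1 + Real.log G.maxDegree) / ε ∧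
            (∀ ω : V → (P N D).Seed,
              (P N D).TerminatesWithin port ω T ∧
              (P N D).MessagesAtMost port ω (K * Real.log (Fintype.card V)) ∧
              ∃ x, IsFractionalMatching G x ∧ (P N D).Outputs port ω T x) ∧
            1 - 1 / (Fintype.card V : ℝ) ^ 5 ≤
              ((P N D).seedMeasure V).real
                {ω | (∃ x, IsFractionalMatching G x ∧ (P N D).Outputs port ω T x ∧
                        maxFractionalMatching G ≤ (2 + 100 * ε) * fractionalSize G x) ∧
                      (P N D).avgAwakeComplexity port ω ≤ K / ε ^ 3} := by
  have hc1 : (1 : ℝ) ≤ c := by exact_mod_cast hc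
  have hc8 : (1 : ℝ) ≤ (c : ℝ) ^ 8 := one_le_pow₀ hc1
  have hcc : (c : ℝ) ≤ (c : ℝ) ^ 8 := by simpa using pow_le_pow_right₀ hc1 (by norm_num : 1 ≤ 8)
  refine ⟨10 ^ 12 * (c : ℝ) ^ 8, by positivity, fun ε hε hε' => ⟨fun _ D =>
    levelProgram (levelWeight ε D) (1 - 2 * ε) (sampleProb ε D) (sampleProb_pos hε)
      (sampleProb_le_one hε) (sampledLevels ε D) (numLevels ε D), ?_⟩⟩
  intro V _ _ _ G _ port _ D _ _ hD hD' hm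
  have hnL := sampledLevels_le ε D
  have hΔ0 : 0 ≤ Real.log G.maxDegree := Real.log_natCast_nonneg _
  have hlogD := log_degree_bound_le hD'
  refine ⟨numLevels ε D + 2, ?_, fun ω => ⟨levelProgram_terminatesWithin port ω hnL, ?_, _,
    isFractionalMatching_prunedWeights (levelWeight_pos hε) _, levelProgram_outputs port ω hnL⟩, ?_⟩
  · have h1 := numLevels_le (D := D) hε hε'
    have h2 : (numLevels ε D : ℝ) * ε ≤ 2 * Real.log D + ε := by
      have := mul_le_mul_of_nonneg_right h1 hε.le
      rwa [add_mul, div_mul_cancel₀ _ hε.ne', one_mul] at this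
    rw [le_div_iff₀ hε]
    push_cast
    have h3 : (c : ℝ) * Real.log G.maxDegree ≤ (c : ℝ) ^ 8 * Real.log G.maxDegree := by gcongr
    nlinarith
  · have hl0 : 0 ≤ Real.log (Fintype.card V) := Real.log_natCast_nonneg _
    have hK : 10 ^ 12 * Real.log (Fintype.card V)
        ≤ 10 ^ 12 * (c : ℝ) ^ 8 * Real.log (Fintype.card V) := by
      refine mul_le_mul_of_nonneg_right ?_ hl0
      linarith
    refine levelProgram_messagesAtMost port ω hnL (fun v hv => ?_) fun hn g hg l hl => ?_
    · have h2 : 2 ≤ Fintype.card V := by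
        have := G.degree_lt_card_verts v
        omega
      have h3 : Real.log 2 ≤ Real.log (Fintype.card V) :=
        Real.log_le_log (by norm_num) (by exact_mod_cast h2)
      have := Real.log_two_gt_d9
      linarith
    · obtain ⟨hN2, -, -, -, hLm, hmN⟩ := sampled_case_bounds hε hε' hc hD' hm
        (Nat.pos_of_ne_zero hn)
      have hL : numLevels ε D ≤ Fintype.card V := by exact_mod_cast hLm.trans hmN
      have := length_bits_pair_le hN2 hL hg hl
      linarith
  · refine (prodProb_program_succeeds hε hε' hc hD hD' hm).trans ?_
    refine le_trans ?_ (seedMeasure_real_eq (w := levelWeight ε D) (a := 1 - 2 * ε)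
      (p := sampleProb ε D) (hp0 := sampleProb_pos hε) (hp1 := sampleProb_le_one hε) (L := numLevels ε D) _).ge
    refine prodProb_mono (isLaw_bits hε _) fun ω hω => ?_
    obtain ⟨h1, h2⟩ := program_succeeds hε hε' hD port ω hω.1 hω.2
    refine ⟨h1, h2.trans ?_⟩
    gcongr
    linarith
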